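/- Let $d\ge 1$ and let $D\subset\mathbb{R}^d$ be a domain (a nonempty connected open set) of finite Lebesgue measure. Functions on $D$ that agree almost everywhere are identified. Let $$\mathrm{BL}(D)=\Big\{u\in L^2_{loc}(D):\ \tfrac{\partial u}{\partial x_i}\in L^2(D),\ 1\le i\le d\Big\},\qquad \mathbf{D}(u,v)=\sum_{i=1}^d\int_D\frac{\partial u}{\partial x_i}\frac{\partial v}{\partial x_i}\,dx\quad(u,v\in \mathrm{BL}(D)),$$ with derivatives in the sense of distributions, and let $W^{1,2}(D)=\mathrm{BL}(D)\cap L^2(D)$. Then: (i) $(\tfrac12\mathbf{D},W^{1,2}(D))$ is a Dirichlet form on $L^2(D)$, i.e. a densely defined, nonnegative, symmetric, closed bilinear form on which the unit contraction $u\mapsto (0\vee u)\wedge 1$ operates. (ii) This form is recurrent: let $(T_t)_{t>0}$ be the strongly continuous symmetric contraction semigroup on $L^2(D)$ that it generates, and let $S_t$ be the bounded operator on $L^1(D)$ that extends $f\mapsto\int_0^tT_sf\,ds$ from $L^1(D)\cap L^2(D)$. Then for every $f\in L^1(D)$ with $f\ge 0$ a.e., the limit $Gf=\lim_{N\to\infty}S_Nf\in[0,\infty]$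 exists a.e. and the set $\{0<Gf<\infty\}$ has Lebesgue measure zero. (iii) Let the extended Sobolev space $W^{1,2}_e(D)$ be the set of all a.e. finite measurable functions $u$ on $D$ that have an approximating sequence, i.e. a sequence $u_n\in W^{1,2}(D)$ with $\mathbf{D}(u_m-u_n,u_m-u_n)\to0$ as $m,n\to\infty$ and $u_n\to u$ a.e. on $D$. Then $W^{1,2}_e(D)=\mathrm{BL}(D)$, and $\tfrac12\mathbf{D}(u_n,u_n)\to\tfrac12\mathbf{D}(u,u)$ for every $u\in W^{1,2}_e(D)$ and every approximating sequence $(u_n)$ of $u$. -/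

import Mathlib

open MeasureTheory Filter Topology Set
open scoped ENNReal ContDiff

noncomputable section

namespace BeppoLevi

/-! ### Dirichlet forms on `L²(μ)`

A form is given by its domain `F ⊆ L²(μ)` and a function `E` of two arguments; only the values of `E`
on `F × F` matter. -/

section General

variable {α : Type*} [MeasurableSpace α] {μ : Measure α}

/-- A sequence in `F` that is `E`-Cauchy. -/
def IsFormCauchy (F : Set (Lp ℝ 2 μ)) (E : Lp ℝ 2 μ → Lp ℝ 2 μ → ℝ) (u : ℕ → Lp ℝ 2 μ) : Prop :=
  (∀ n, u n ∈ F) ∧ ∀ ε > 0, ∃ N, ∀ m ≥ N, ∀ n ≥ N, E (u m - u n) (u m - u n) < ε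

/-- `E₁(u, v) = E(u, v) + (u, v)_{L²}`. -/
def formOne (E : Lp ℝ 2 μ → Lp ℝ 2 μ → ℝ) (u v : Lp ℝ 2 μ) : ℝ :=
  E u v + inner ℝ u v

/-- `(E, F)` is a (symmetric) Dirichlet form on `L²(μ)`: a densely defined, nonnegative, symmetric,
closed bilinear form on which the unit contraction operates. -/
structure IsDirichletForm (F : Set (Lp ℝ 2 μ)) (E : Lp ℝ 2 μ → Lp ℝ 2 μ → ℝ) : Prop where
  zero_mem : (0 : Lp ℝ 2 μ) ∈ F
  add_mem : ∀ u ∈ F, ∀ v ∈ F, u + v ∈ F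
  smul_mem : ∀ c : ℝ, ∀ u ∈ F, c • u ∈ F
  dense : Dense F
  add_left : ∀ u ∈ F, ∀ v ∈ F, ∀ w ∈ F, E (u + v) w = E u w + E v w
  smul_left : ∀ c : ℝ, ∀ u ∈ F, ∀ v ∈ F, E (c • u) v = c * E u v
  symm : ∀ u ∈ F, ∀ v ∈ F, E u v = E v u
  nonneg : ∀ u ∈ F, 0 ≤ E u u
  closed : ∀ u : ℕ → Lp ℝ 2 μ, IsFormCauchy F (formOne E) u →
    ∃ v ∈ F, Tendsto (fun n => formOne E (u n - v) (u n - v)) atTop (𝓝 0)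
  markov : ∀ u ∈ F, ∃ v ∈ F, (v =ᵐ[μ] fun x => min (max (u x) 0) 1) ∧ E v v ≤ E u u

/-- `(T_t)_{t > 0}` is the strongly continuous symmetric contraction semigroup on `L²(μ)` generated by
the form `(E, F)`: its infinitesimal generator is the operator `A` associated with the form, i.e.
`u ∈ D(A)` and `A u = w` if and only if `u ∈ F` and `E(u, v) = -(w, v)` for all `v ∈ F`. -/
structure IsSemigroupOf (F : Set (Lp ℝ 2 μ)) (E : Lp ℝ 2 μ → Lp ℝ 2 μ → ℝ)
    (T : ℝ → Lp ℝ 2 μ →L[ℝ] Lp ℝ 2 μ) : Prop where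
  symm : ∀ t > 0, ∀ f g : Lp ℝ 2 μ, inner ℝ (T t f) g = inner ℝ f (T t g)
  semigroup : ∀ s > 0, ∀ t > 0, ∀ f : Lp ℝ 2 μ, T (s + t) f = T s (T t f)
  contraction : ∀ t > 0, ∀ f : Lp ℝ 2 μ, ‖T t f‖ ≤ ‖f‖
  strong_cont : ∀ f : Lp ℝ 2 μ, Tendsto (fun t => T t f) (𝓝[>] 0) (𝓝 f)
  generator : ∀ u w : Lp ℝ 2 μ,
    Tendsto (fun t : ℝ => t⁻¹ • (T t u - u)) (𝓝[>] 0) (𝓝 w) ↔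
      u ∈ F ∧ ∀ v ∈ F, E u v = -inner ℝ w v

/-- `(S_t)_{t > 0}` are the bounded operators on `L¹(μ)` that extend `f ↦ ∫₀ᵗ T_s f ds` (a Bochner
integral in `L²(μ)`) from `L¹(μ) ∩ L²(μ)`. -/
def IsL1Extension (T : ℝ → Lp ℝ 2 μ →L[ℝ] Lp ℝ 2 μ) (S : ℝ → Lp ℝ 1 μ →L[ℝ] Lp ℝ 1 μ) : Prop :=
  ∀ t > 0, ∀ (f : Lp ℝ 1 μ) (g : Lp ℝ 2 μ), f =ᵐ[μ] g →
    (S t f : α → ℝ) =ᵐ[μ] (∫ s in (0 : ℝ)..t, T s g : Lp ℝ 2 μ)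

/-- `g = G f`, where `G f = lim_{N → ∞} S_N f` almost everywhere, with values in `[-∞, ∞]`. -/
def IsPotential (S : ℝ → Lp ℝ 1 μ →L[ℝ] Lp ℝ 1 μ) (f : Lp ℝ 1 μ) (g : α → EReal) : Prop :=
  ∀ᵐ x ∂μ, Tendsto (fun N : ℕ => ((S (N : ℝ) f x : ℝ) : EReal)) atTop (𝓝 (g x))

/-- The form `(E, F)` is recurrent: for its semigroup `T`, the potential `G f` satisfies
`μ(0 < G f < ∞) = 0` for every nonnegative `f ∈ L¹(μ)`. -/
def IsRecurrent (F : Set (Lp ℝ 2 μ)) (E : Lp ℝ 2 μ → Lp ℝ 2 μ → ℝ) : Prop :=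
  ∃ T : ℝ → Lp ℝ 2 μ →L[ℝ] Lp ℝ 2 μ, IsSemigroupOf F E T ∧
    ∃ S : ℝ → Lp ℝ 1 μ →L[ℝ] Lp ℝ 1 μ, IsL1Extension T S ∧
      ∀ f : Lp ℝ 1 μ, (∀ᵐ x ∂μ, 0 ≤ f x) →
        ∃ g : α → EReal, IsPotential S f g ∧ μ {x | 0 < g x ∧ g x < ⊤} = 0

/-- `(u_n)` is an approximating sequence of the (a.e. finite) function `u`: it lies in `F`, is
`E`-Cauchy and converges to `u` almost everywhere. -/
def IsApproximating (F : Set (Lp ℝ 2 μ)) (E : Lp ℝ 2 μ → Lp ℝ 2 μ → ℝ)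
    (v : ℕ → Lp ℝ 2 μ) (u : α →ₘ[μ] ℝ) : Prop :=
  IsFormCauchy F E v ∧ ∀ᵐ x ∂μ, Tendsto (fun n => v n x) atTop (𝓝 (u x))

/-- The extended Dirichlet space `F_e`. -/
def extendedSpace (F : Set (Lp ℝ 2 μ)) (E : Lp ℝ 2 μ → Lp ℝ 2 μ → ℝ) : Set (α →ₘ[μ] ℝ) :=
  {u | ∃ v : ℕ → Lp ℝ 2 μ, IsApproximating F E v u}

end General

/-! ### Beppo Levi functions and the Sobolev space on `D ⊆ ℝ^d` -/

section Euclidean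

variable {d : ℕ}

/-- `g` is the distributional partial derivative `∂u/∂x_i` on `D`. -/
def HasWeakPartial (D : Set (EuclideanSpace ℝ (Fin d))) (i : Fin d)
    (u g : EuclideanSpace ℝ (Fin d) → ℝ) : Prop :=
  ∀ φ : EuclideanSpace ℝ (Fin d) → ℝ, ContDiff ℝ ∞ φ → HasCompactSupport φ → tsupport φ ⊆ D →
    ∫ x in D, u x * fderiv ℝ φ x (EuclideanSpace.single i 1) = -∫ x in D, g x * φ x

/-- `BL(D)`: functions in `L²_loc(D)`, up to a.e. equality, with distributional partial derivatives in
`L²(D)`. -/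
def BL (D : Set (EuclideanSpace ℝ (Fin d))) :
    Set (EuclideanSpace ℝ (Fin d) →ₘ[volume.restrict D] ℝ) :=
  {u | (∀ K ⊆ D, IsCompact K → MemLp u 2 (volume.restrict K)) ∧
    ∀ i, ∃ g : Lp ℝ 2 (volume.restrict D), HasWeakPartial D i u g}

open Classical in
/-- The distributional partial derivative `∂u/∂x_i` in `L²(D)` (zero if there is none). -/
def weakPartial (D : Set (EuclideanSpace ℝ (Fin d))) (i : Fin d)
    (u : EuclideanSpace ℝ (Fin d) →ₘ[volume.restrict D] ℝ) : Lp ℝ 2 (volume.restrict D) :=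
  if h : ∃ g : Lp ℝ 2 (volume.restrict D), HasWeakPartial D i u g then h.choose else 0

/-- The Dirichlet integral `𝐃(u, v) = ∑ i, ∫_D ∂u/∂x_i ∂v/∂x_i dx`. -/
def dirichletIntegral (D : Set (EuclideanSpace ℝ (Fin d)))
    (u v : EuclideanSpace ℝ (Fin d) →ₘ[volume.restrict D] ℝ) : ℝ :=
  ∑ i, ∫ x in D, weakPartial D i u x * weakPartial D i v x

/-- `W^{1,2}(D) = BL(D) ∩ L²(D)`. -/
def W12 (D : Set (EuclideanSpace ℝ (Fin d))) : Set (Lp ℝ 2 (volume.restrict D)) :=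
  {u | (u : EuclideanSpace ℝ (Fin d) →ₘ[volume.restrict D] ℝ) ∈ BL D}

/-- The form `½ 𝐃` on `L²(D)`. -/
def halfD (D : Set (EuclideanSpace ℝ (Fin d))) (u v : Lp ℝ 2 (volume.restrict D)) : ℝ :=
  1 / 2 * dirichletIntegral D u v

end Euclidean

end BeppoLevi

end

/-! The analytic core is one translation estimate: if `u` has a distributional derivative `g` in
direction `h`, then `u(· + h) - u` has `L²` norm at most `‖g‖` on any open set whose translates by
`t h`, `0 ≤ t ≤ 1`, stay in a compact subset of `D` (`eLpNorm_translate_sub_le`). It has two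
consequences. First, a normal contraction `N` does not increase differences, so the difference
quotients of `N ∘ u` are bounded by those of `u`; by Riesz representation `N ∘ u` has a derivative
of no larger norm (`HasWeakDeriv.comp_lipschitz`). Second, integrating over `h` gives a Poincaré
inequality on balls, whence a function with zero gradient on a connected set is constant
(`exists_ae_eq_const`). Together with the closedness of the gradient and the density of test
functions, the contraction property gives (i).

For (iii), let `u_n` be an approximating sequence. On a small ball, Egorov's theorem gives uniform
convergence on a subset of positive measure, and the Poincaré inequality carries this over to the
whole ball. Hence `u_n → u` in `L²_loc`, so `u ∈ BL(D)` and the gradients converge to that of `u`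
(`IsApproximating.mem_BL`). Conversely, truncations of `u ∈ BL(D)` are bounded, hence in `L²(D)`
because the volume is finite. Their gradients converge weakly with norms bounded by that of the
limit, hence strongly (`exists_isApproximating`).

For (ii), the resolvent equation is solved by projecting onto the graph of a multiple of the
gradient (`exists_resolvent_halfD`), and the Yosida approximations produce the semigroup. The
contraction `u ↦ u⁺` makes the resolvent, and so the semigroup, positive. Constants lie in
`W^{1,2}(D)` with zero gradient, so they are invariant and mass is conserved; this bounds `S_t` on
`L¹`. If `f ≥ 0` is not zero, put `h = f ∧ 1`. By the mean ergodic theorem the averages of `T_s h`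
converge in `L²` to an invariant vector, which has zero gradient and is therefore constant; by
conservation of mass the constant is positive. Since `S_N f` dominates `N` times the average, and is
monotone in `N`, it tends to `∞` almost everywhere (`tendsto_potentialOperator_atTop`). Thus `G f`
is either zero or infinite throughout `D`. -/

noncomputable section

namespace BeppoLevi

/-! ### Resolvents and Yosida approximations of a nonpositive self-adjoint operator -/

section HilleYosida

variable {H : Type*} [NormedAddCommGroup H] [InnerProductSpace ℝ H]

/-- The graph of a nonpositive self-adjoint operator: symmetric, nonpositive, single-valued, and
`1 - c A` is onto for all `c > 0`. -/
structure IsDissipative (A : Submodule ℝ (H × H)) : Prop where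
  symm : ∀ p ∈ A, ∀ q ∈ A, inner ℝ p.2 q.1 = inner ℝ p.1 q.2
  nonpos : ∀ p ∈ A, inner ℝ p.2 p.1 ≤ 0
  single : ∀ w, ((0 : H), w) ∈ A → w = 0
  surj : ∀ c : ℝ, 0 < c → ∀ f : H, ∃ p ∈ A, p.1 - c • p.2 = f

namespace IsDissipative

variable {A : Submodule ℝ (H × H)}

/-- Pair `p.1 - c • p.2` with `p.1` and use Cauchy–Schwarz. Both the injectivity of `1 - c A` and
the contractivity of its inverse come from here. -/
theorem norm_fst_le (hA : IsDissipative A) {c : ℝ} (hc : 0 < c) {p : H × H} (hp : p ∈ A) :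
    ‖p.1‖ ≤ ‖p.1 - c • p.2‖ := by
  have h1 : inner ℝ (p.1 - c • p.2) p.1 = ‖p.1‖ ^ 2 - c * inner ℝ p.2 p.1 := by
    rw [inner_sub_left, real_inner_smul_left, real_inner_self_eq_norm_sq]
  have h2 := real_inner_le_norm (p.1 - c • p.2) p.1
  have h3 := mul_nonneg hc.le (neg_nonneg.2 (hA.nonpos p hp))
  have h4 : ‖p.1‖ * ‖p.1‖ ≤ ‖p.1 - c • p.2‖ * ‖p.1‖ := by nlinarith
  rcases (norm_nonneg p.1).eq_or_lt with h | h
  · rw [← h]; positivity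
  · exact le_of_mul_le_mul_right h4 h

theorem eq_of_sub_smul_eq (hA : IsDissipative A) {c : ℝ} (hc : 0 < c) {p q : H × H} (hp : p ∈ A)
    (hq : q ∈ A) (h : p.1 - c • p.2 = q.1 - c • q.2) : p.1 = q.1 := by
  have h1 := hA.norm_fst_le hc (A.sub_mem hp hq)
  have h2 : (p - q).1 - c • (p - q).2 = 0 := by
    simp only [Prod.fst_sub, Prod.snd_sub, smul_sub]
    rw [← sub_eq_zero] at h
    rw [← h]; abel
  rw [h2, norm_zero, norm_le_zero_iff] at h1
  exact sub_eq_zero.1 h1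

theorem exists_resolvent (hA : IsDissipative A) {c : ℝ} (hc : 0 < c) :
    ∃ J : H →L[ℝ] H, ∀ f, (J f, c⁻¹ • (J f - f)) ∈ A := by
  choose P hP hPf using hA.surj c hc
  have hlin : ∀ p ∈ A, (P (p.1 - c • p.2)).1 = p.1 := fun p hp =>
    hA.eq_of_sub_smul_eq hc (hP _) hp (hPf _)
  let J : H →ₗ[ℝ] H :=
    { toFun := fun f => (P f).1
      map_add' := fun f g => by
        rw [← Prod.fst_add, ← hlin _ (A.add_mem (hP f) (hP g))]
        congr 2
        conv_lhs => rw [← hPf f, ← hPf g]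
        simp only [Prod.fst_add, Prod.snd_add, smul_add]; abel
      map_smul' := fun a f => by
        rw [RingHom.id_apply, ← Prod.smul_fst, ← hlin _ (A.smul_mem a (hP f))]
        congr 2
        conv_lhs => rw [← hPf f]
        simp only [Prod.smul_fst, Prod.smul_snd, smul_sub, smul_comm a c] }
  refine ⟨J.mkContinuous 1 fun f => ?_, fun f => ?_⟩
  · have := hA.norm_fst_le hc (hP f)
    rw [hPf] at this
    simpa [J] using this
  · have : c⁻¹ • ((P f).1 - f) = (P f).2 := by
      have e : (P f).1 - f = c • (P f).2 := by rw [sub_eq_iff_eq_add, ← sub_eq_iff_eq_add', hPf]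
      rw [e, smul_smul, inv_mul_cancel₀ hc.ne', one_smul]
    change ((P f).1, c⁻¹ • ((P f).1 - f)) ∈ A
    rw [this]
    exact hP f

open Classical in
/-- The resolvent `(1 - c A)⁻¹` (zero if `c ≤ 0`). -/
def resolvent (hA : IsDissipative A) (c : ℝ) : H →L[ℝ] H :=
  if hc : 0 < c then (hA.exists_resolvent hc).choose else 0

theorem resolvent_mem (hA : IsDissipative A) {c : ℝ} (hc : 0 < c) (f : H) :
    (hA.resolvent c f, c⁻¹ • (hA.resolvent c f - f)) ∈ A := by
  rw [resolvent, dif_pos hc]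
  exact (hA.exists_resolvent hc).choose_spec f

theorem resolvent_apply_sub (hA : IsDissipative A) {c : ℝ} (hc : 0 < c) {p : H × H} (hp : p ∈ A) :
    hA.resolvent c (p.1 - c • p.2) = p.1 := by
  refine hA.eq_of_sub_smul_eq hc (hA.resolvent_mem hc _) hp ?_
  simp [smul_smul, hc.ne']

theorem norm_resolvent_apply_le (hA : IsDissipative A) {c : ℝ} (hc : 0 < c) (f : H) :
    ‖hA.resolvent c f‖ ≤ ‖f‖ := by
  have := hA.norm_fst_le hc (hA.resolvent_mem hc f)
  simpa [smul_smul, hc.ne'] using this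

/-- The Yosida approximation of the operator. -/
def yosida (hA : IsDissipative A) (c : ℝ) : H →L[ℝ] H :=
  c⁻¹ • (hA.resolvent c - 1)

theorem yosida_apply (hA : IsDissipative A) (c : ℝ) (f : H) :
    hA.yosida c f = c⁻¹ • (hA.resolvent c f - f) := rfl

/-- On the domain, the Yosida approximation is the resolvent applied after `A`. Hence it is bounded
there uniformly in `c` and converges to `A` as `c → 0`. -/
theorem yosida_apply_fst (hA : IsDissipative A) {c : ℝ} (hc : 0 < c) {p : H × H} (hp : p ∈ A) :
    hA.yosida c p.1 = hA.resolvent c p.2 := by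
  have h := hA.resolvent_apply_sub hc hp
  rw [map_sub, map_smul] at h
  rw [yosida_apply]
  nth_rewrite 2 [← h]
  simp [smul_smul, hc.ne']

theorem resolvent_map_mem (hA : IsDissipative A) {c : ℝ} (hc : 0 < c) {p : H × H} (hp : p ∈ A) :
    (hA.resolvent c p.1, hA.resolvent c p.2) ∈ A := by
  rw [← hA.yosida_apply_fst hc hp]
  exact hA.resolvent_mem hc p.1

/-- A resolvent maps the graph of `A` into itself, so applying it to the equation defining the other
resolvent yields that same equation with transformed data. -/
theorem commute_resolvent (hA : IsDissipative A) {c e : ℝ} (hc : 0 < c) (he : 0 < e) :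
    Commute (hA.resolvent c) (hA.resolvent e) := by
  ext f
  change hA.resolvent c (hA.resolvent e f) = hA.resolvent e (hA.resolvent c f)
  have h := hA.resolvent_apply_sub he (hA.resolvent_map_mem hc (hA.resolvent_mem he f))
  simpa [smul_smul, he.ne'] using h.symm

theorem commute_yosida (hA : IsDissipative A) {c e : ℝ} (hc : 0 < c) (he : 0 < e) :
    Commute (hA.yosida c) (hA.yosida e) :=
  ((((hA.commute_resolvent hc he).sub_left (Commute.one_left _)).sub_right
    (Commute.one_right _)).smul_left _).smul_right _

theorem inner_resolvent (hA : IsDissipative A) {c : ℝ} (hc : 0 < c) (f g : H) :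
    inner ℝ (hA.resolvent c f) g = inner ℝ f (hA.resolvent c g) := by
  have h := hA.symm _ (hA.resolvent_mem hc f) _ (hA.resolvent_mem hc g)
  simp only [real_inner_smul_left, real_inner_smul_right, inner_sub_left, inner_sub_right] at h
  have := mul_left_cancel₀ (inv_ne_zero hc.ne') h
  linarith

theorem inner_yosida (hA : IsDissipative A) {c : ℝ} (hc : 0 < c) (f g : H) :
    inner ℝ (hA.yosida c f) g = inner ℝ f (hA.yosida c g) := by
  simp only [yosida_apply, real_inner_smul_left, real_inner_smul_right, inner_sub_left,
    inner_sub_right, hA.inner_resolvent hc]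

theorem inner_yosida_self_nonpos (hA : IsDissipative A) {c : ℝ} (hc : 0 < c) (f : H) :
    inner ℝ (hA.yosida c f) f ≤ 0 := by
  rw [yosida_apply, real_inner_smul_left, inner_sub_left, real_inner_self_eq_norm_sq]
  refine mul_nonpos_of_nonneg_of_nonpos (inv_nonneg.2 hc.le) ?_
  have h1 := real_inner_le_norm (hA.resolvent c f) f
  have h2 := hA.norm_resolvent_apply_le hc f
  nlinarith [norm_nonneg f]

/-- If `h` is orthogonal to the domain, nonpositivity at `J h`, where `J = (1 - A)⁻¹`, forces `J h =
0`. Then `(0, -h)` is in the graph and single-valuedness gives `h = 0`. -/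
theorem dense_domain [CompleteSpace H] (hA : IsDissipative A) :
    Dense ((A.map (LinearMap.fst ℝ H H) : Submodule ℝ H) : Set H) := by
  rw [Submodule.dense_iff_topologicalClosure_eq_top, Submodule.topologicalClosure_eq_top_iff,
    Submodule.eq_bot_iff]
  intro h hh
  have hm := hA.resolvent_mem one_pos h
  have h0 : inner ℝ (hA.resolvent 1 h) h = 0 :=
    (Submodule.mem_orthogonal _ _).1 hh _ (Submodule.mem_map.2 ⟨_, hm, rfl⟩)
  have h1 := hA.nonpos _ hm
  simp only [inv_one, one_smul, inner_sub_left, real_inner_self_eq_norm_sq] at h1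
  rw [real_inner_comm, h0, sub_zero] at h1
  have h2 : hA.resolvent 1 h = 0 := by
    rw [← norm_eq_zero]; nlinarith [norm_nonneg (hA.resolvent 1 h)]
  rw [h2] at hm
  simpa using hA.single _ hm

theorem exists_mem_norm_sub_lt [CompleteSpace H] (hA : IsDissipative A) (f : H) {ε : ℝ}
    (hε : 0 < ε) : ∃ p ∈ A, ‖f - p.1‖ < ε := by
  obtain ⟨g, hg, hfg⟩ := hA.dense_domain.exists_dist_lt f hε
  obtain ⟨p, hp, rfl⟩ := Submodule.mem_map.1 hg
  exact ⟨p, hp, by simpa [dist_eq_norm] using hfg⟩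

theorem norm_resolvent_sub_le (hA : IsDissipative A) {c : ℝ} (hc : 0 < c) {p : H × H}
    (hp : p ∈ A) : ‖hA.resolvent c p.1 - p.1‖ ≤ c * ‖p.2‖ := by
  have h : hA.resolvent c p.1 - p.1 = c • hA.resolvent c p.2 := by
    rw [← hA.yosida_apply_fst hc hp, yosida_apply, smul_smul, mul_inv_cancel₀ hc.ne', one_smul]
  rw [h, norm_smul, Real.norm_of_nonneg hc.le]
  exact mul_le_mul_of_nonneg_left (hA.norm_resolvent_apply_le hc _) hc.le

theorem tendsto_resolvent [CompleteSpace H] (hA : IsDissipative A) (f : H) :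
    Tendsto (fun c => hA.resolvent c f) (𝓝[>] 0) (𝓝 f) := by
  rw [Metric.tendsto_nhds]
  intro ε hε
  obtain ⟨p, hp, hfp⟩ := hA.exists_mem_norm_sub_lt f (show 0 < ε / 4 by positivity)
  have hlim : Tendsto (fun c : ℝ => c * ‖p.2‖) (𝓝[>] 0) (𝓝 0) := by
    have : Tendsto (fun c : ℝ => c * ‖p.2‖) (𝓝 0) (𝓝 (0 * ‖p.2‖)) :=
      tendsto_id.mul_const _
    rw [zero_mul] at this
    exact this.mono_left nhdsWithin_le_nhds
  filter_upwards [self_mem_nhdsWithin, hlim.eventually_lt_const (show 0 < ε / 4 by positivity)]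
    with c hc h
  rw [dist_eq_norm]
  have h1 : hA.resolvent c f - f =
      hA.resolvent c (f - p.1) + (hA.resolvent c p.1 - p.1) - (f - p.1) := by
    rw [map_sub]; abel
  rw [h1]
  have h2 := hA.norm_resolvent_apply_le hc (f - p.1)
  have h3 := hA.norm_resolvent_sub_le hc hp
  have h4 := norm_sub_le (hA.resolvent c (f - p.1) + (hA.resolvent c p.1 - p.1)) (f - p.1)
  have h5 := norm_add_le (hA.resolvent c (f - p.1)) (hA.resolvent c p.1 - p.1)
  linarith

theorem norm_yosida_fst_le (hA : IsDissipative A) {c : ℝ} (hc : 0 < c) {p : H × H} (hp : p ∈ A) :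
    ‖hA.yosida c p.1‖ ≤ ‖p.2‖ := by
  rw [hA.yosida_apply_fst hc hp]
  exact hA.norm_resolvent_apply_le hc _

end IsDissipative

/-! ### Exponentials of bounded nonpositive operators -/

section Exp

open NormedSpace (exp)

theorem exp_smul_apply_comm {X Y : H →L[ℝ] H} (h : Commute X Y) (t : ℝ) (f : H) :
    exp (t • X) (Y f) = Y (exp (t • X) f) := by
  have := ((h.symm.smul_right t).exp_right)
  exact (DFunLike.congr_fun this f).symm

variable [CompleteSpace H]

theorem hasDerivAt_exp_smul_apply (X : H →L[ℝ] H) (f : H) (t : ℝ) :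
    HasDerivAt (fun s : ℝ => exp (s • X) f) (exp (t • X) (X f)) t := by
  have := (hasDerivAt_exp_smul_const (𝕂 := ℝ) X t).clm_apply (hasDerivAt_const t f)
  simpa using this

theorem exp_add_smul_apply (X : H →L[ℝ] H) (s t : ℝ) (f : H) :
    exp ((s + t) • X) f = exp (s • X) (exp (t • X) f) := by
  let _ := NormedAlgebra.restrictScalars ℚ ℝ (H →L[ℝ] H)
  rw [add_smul, NormedSpace.exp_add_of_commute (((Commute.refl X).smul_left s).smul_right t)]
  rfl

theorem norm_exp_smul_apply_le {X : H →L[ℝ] H} (hX : ∀ f, inner ℝ (X f) f ≤ 0) {t : ℝ}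
    (ht : 0 ≤ t) (f : H) : ‖exp (t • X) f‖ ≤ ‖f‖ := by
  have hd : ∀ s : ℝ, HasDerivAt (fun s : ℝ => ‖exp (s • X) f‖ ^ 2)
      (2 * inner ℝ (exp (s • X) f) (exp (s • X) (X f))) s := fun s =>
    (hasDerivAt_exp_smul_apply X f s).norm_sq
  have hanti : Antitone (fun s : ℝ => ‖exp (s • X) f‖ ^ 2) := by
    refine antitone_of_deriv_nonpos (fun s => (hd s).differentiableAt) fun s => ?_
    rw [(hd s).deriv, exp_smul_apply_comm (Commute.refl X), real_inner_comm]
    linarith [hX (exp (s • X) f)]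
  have := hanti ht
  simp only [zero_smul, NormedSpace.exp_zero, one_apply_eq_self] at this
  exact (sq_le_sq₀ (norm_nonneg _) (norm_nonneg _)).1 this

/-- The curve `s ↦ e^{sX} e^{(t-s)Y} f` joins the two vectors, and by commutation its velocity is
`e^{sX} e^{(t-s)Y} (X f - Y f)`. Both exponentials are contractions. -/
theorem norm_exp_smul_sub_exp_smul_le {X Y : H →L[ℝ] H} (hXY : Commute X Y)
    (hX : ∀ f, inner ℝ (X f) f ≤ 0) (hY : ∀ f, inner ℝ (Y f) f ≤ 0) {t : ℝ} (ht : 0 ≤ t) (f : H) :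
    ‖exp (t • X) f - exp (t • Y) f‖ ≤ t * ‖X f - Y f‖ := by
  have hd : ∀ s : ℝ, HasDerivAt (fun s : ℝ => exp (s • X) (exp ((t - s) • Y) f))
      (exp (s • X) (exp ((t - s) • Y) (X f - Y f))) s := by
    intro s
    have h1 := hasDerivAt_exp_smul_const (𝕂 := ℝ) X s
    have h2 : HasDerivAt (fun s : ℝ => exp ((t - s) • Y) f) (-exp ((t - s) • Y) (Y f)) s := by
      simpa [Function.comp_def] using
        (hasDerivAt_exp_smul_apply Y f (t - s)).scomp s ((hasDerivAt_id s).const_sub t)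
    convert h1.clm_apply h2 using 1
    rw [map_sub, map_sub, map_neg, exp_smul_apply_comm hXY.symm, sub_eq_add_neg]
    rfl
  have := norm_image_sub_le_of_norm_deriv_le_segment' (a := 0) (b := t)
    (fun s _ => (hd s).hasDerivWithinAt) (C := ‖X f - Y f‖) (fun s hs =>
      (norm_exp_smul_apply_le hX hs.1 _).trans (norm_exp_smul_apply_le hY (by linarith [hs.2]) _))
    t (right_mem_Icc.2 ht)
  simpa [mul_comm] using this

theorem norm_exp_smul_sub_le {X : H →L[ℝ] H} (hX : ∀ f, inner ℝ (X f) f ≤ 0) {t : ℝ} (ht : 0 ≤ t)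
    (f : H) : ‖exp (t • X) f - f‖ ≤ t * ‖X f‖ := by
  simpa using norm_exp_smul_sub_exp_smul_le (Y := 0) (Commute.zero_right X) hX (by simp) ht f

theorem norm_exp_smul_sub_sub_le (X : H →L[ℝ] H) {t C : ℝ} (ht : 0 ≤ t) (f : H)
    (hC : ∀ s ∈ Ico 0 t, ‖exp (s • X) (X f) - X f‖ ≤ C) :
    ‖exp (t • X) f - f - t • X f‖ ≤ C * t := by
  have hd : ∀ s : ℝ, HasDerivAt (fun s : ℝ => exp (s • X) f - s • X f)
      (exp (s • X) (X f) - X f) s := by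
    intro s
    simpa using (hasDerivAt_exp_smul_apply X f s).fun_sub ((hasDerivAt_id s).smul_const (X f))
  have := norm_image_sub_le_of_norm_deriv_le_segment' (a := 0) (b := t)
    (fun s _ => (hd s).hasDerivWithinAt) hC t (right_mem_Icc.2 ht)
  simp only [zero_smul, NormedSpace.exp_zero, one_apply_eq_self, sub_zero] at this
  rwa [sub_right_comm]

theorem inner_exp_smul {X : H →L[ℝ] H} (hX : ∀ f g, inner ℝ (X f) g = inner ℝ f (X g)) (t : ℝ)
    (f g : H) : inner ℝ (exp (t • X) f) g = inner ℝ f (exp (t • X) g) := by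
  have h : IsSelfAdjoint (t • X) := by
    rw [ContinuousLinearMap.isSelfAdjoint_iff_isSymmetric]
    intro f g
    simp [real_inner_smul_left, real_inner_smul_right, hX]
  exact (ContinuousLinearMap.isSelfAdjoint_iff_isSymmetric.1 h.exp) f g

/-- For `t ≥ 0` the partial sums of the exponential series are nonnegative combinations of elements
of the closed cone. This transfers positivity from resolvents to the semigroup. -/
theorem exp_smul_mem {C : Set H} (hC : IsClosed C) (h0 : (0 : H) ∈ C)
    (hadd : ∀ f ∈ C, ∀ g ∈ C, f + g ∈ C) (hsmul : ∀ a : ℝ, 0 ≤ a → ∀ f ∈ C, a • f ∈ C)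
    {X : H →L[ℝ] H} (hX : ∀ f ∈ C, X f ∈ C) {t : ℝ} (ht : 0 ≤ t) {f : H} (hf : f ∈ C) :
    exp (t • X) f ∈ C := by
  have hs := NormedSpace.exp_series_hasSum_exp' (𝕂 := ℝ) (t • X)
  have hs' : HasSum (fun n : ℕ => ((n.factorial : ℝ)⁻¹ • (t • X) ^ n) f) (exp (t • X) f) :=
    hs.mapL (ContinuousLinearMap.apply ℝ H f)
  have hpow : ∀ n : ℕ, (X ^ n) f ∈ C := by
    intro n
    induction n with
    | zero => simpa using hf
    | succ n ih => rw [pow_succ']; exact hX _ ih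
  refine hC.mem_of_tendsto hs' (Eventually.of_forall fun s => ?_)
  refine Finset.sum_induction _ (· ∈ C) (fun a b ha hb => hadd a ha b hb) h0 fun n _ => ?_
  rw [smul_pow, smul_smul]
  exact hsmul _ (by positivity) _ (hpow n)

end Exp

end HilleYosida

/-! ### The semigroup as the limit of Yosida approximations -/

section Semigroup

variable {H : Type*} [NormedAddCommGroup H] [InnerProductSpace ℝ H]

open NormedSpace (exp)

theorem tendsto_apply_of_norm_le {T : ℕ → H →L[ℝ] H} (hT : ∀ n f, ‖T n f‖ ≤ ‖f‖) {f : ℕ → H}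
    {g h : H} (hf : Tendsto f atTop (𝓝 g)) (hg : Tendsto (fun n => T n g) atTop (𝓝 h)) :
    Tendsto (fun n => T n (f n)) atTop (𝓝 h) := by
  have h1 : Tendsto (fun n => T n (f n - g)) atTop (𝓝 0) := by
    refine squeeze_zero_norm (fun n => hT n _) ?_
    rw [tendsto_iff_norm_sub_tendsto_zero] at hf
    exact hf
  simpa using h1.add hg

namespace IsDissipative

variable [CompleteSpace H] {A : Submodule ℝ (H × H)}

/-- The semigroups generated by the Yosida approximations. -/
def approx (hA : IsDissipative A) (t : ℝ) (n : ℕ) : H →L[ℝ] H :=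
  -- Clamping the time at `0` makes the orbits contractive and continuous on all of `ℝ`, with the
  -- identity for `t ≤ 0`.
  exp (max t 0 • hA.yosida (1 / ((n : ℝ) + 1)))

theorem norm_approx_apply_le (hA : IsDissipative A) (t : ℝ) (n : ℕ) (f : H) :
    ‖hA.approx t n f‖ ≤ ‖f‖ :=
  norm_exp_smul_apply_le (hA.inner_yosida_self_nonpos Nat.one_div_pos_of_nat) (le_max_right _ _) f

theorem tendsto_yosida_fst (hA : IsDissipative A) {p : H × H} (hp : p ∈ A) :
    Tendsto (fun n : ℕ => hA.yosida (1 / ((n : ℝ) + 1)) p.1) atTop (𝓝 p.2) := by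
  simp_rw [hA.yosida_apply_fst Nat.one_div_pos_of_nat hp]
  exact (hA.tendsto_resolvent p.2).comp (tendsto_nhdsWithin_iff.2
    ⟨tendsto_one_div_add_atTop_nhds_zero_nat, Eventually.of_forall fun _ => mem_Ioi.2 Nat.one_div_pos_of_nat⟩)

theorem cauchySeq_approx_fst (hA : IsDissipative A) (t : ℝ) {p : H × H} (hp : p ∈ A) :
    CauchySeq fun n => hA.approx t n p.1 := by
  have hc := (hA.tendsto_yosida_fst hp).cauchySeq
  rw [Metric.cauchySeq_iff] at hc ⊢
  intro ε hε
  obtain ⟨N, hN⟩ := hc (ε / (max t 0 + 1)) (by positivity)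
  refine ⟨N, fun m hm n hn => ?_⟩
  have h1 := norm_exp_smul_sub_exp_smul_le
    (hA.commute_yosida (Nat.one_div_pos_of_nat (n := m)) (Nat.one_div_pos_of_nat (n := n)))
    (hA.inner_yosida_self_nonpos Nat.one_div_pos_of_nat)
    (hA.inner_yosida_self_nonpos Nat.one_div_pos_of_nat) (le_max_right t 0) p.1
  have h2 := hN m hm n hn
  rw [dist_eq_norm] at h2 ⊢
  rw [lt_div_iff₀ (by positivity)] at h2
  refine h1.trans_lt (lt_of_le_of_lt ?_ h2)
  rw [mul_comm]
  gcongr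
  linarith

theorem cauchySeq_approx (hA : IsDissipative A) (t : ℝ) (f : H) :
    CauchySeq fun n => hA.approx t n f := by
  rw [Metric.cauchySeq_iff]
  intro ε hε
  obtain ⟨p, hp, hfp⟩ := hA.exists_mem_norm_sub_lt f (show 0 < ε / 3 by positivity)
  obtain ⟨N, hN⟩ := Metric.cauchySeq_iff.1 (hA.cauchySeq_approx_fst t hp) (ε / 3) (by positivity)
  refine ⟨N, fun m hm n hn => ?_⟩
  have h1 := hN m hm n hn
  have h2 := hA.norm_approx_apply_le t m (f - p.1)
  have h3 := hA.norm_approx_apply_le t n (f - p.1)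
  rw [dist_eq_norm] at h1 ⊢
  have h4 : hA.approx t m f - hA.approx t n f = hA.approx t m (f - p.1) +
      (hA.approx t m p.1 - hA.approx t n p.1) - hA.approx t n (f - p.1) := by
    simp only [map_sub]; abel
  rw [h4]
  have h5 := norm_sub_le (hA.approx t m (f - p.1) + (hA.approx t m p.1 - hA.approx t n p.1))
    (hA.approx t n (f - p.1))
  have h6 := norm_add_le (hA.approx t m (f - p.1)) (hA.approx t m p.1 - hA.approx t n p.1)
  linarith

theorem exists_tendsto_approx (hA : IsDissipative A) (t : ℝ) :
    ∃ T : H →L[ℝ] H, ∀ f, Tendsto (fun n => hA.approx t n f) atTop (𝓝 (T f)) := by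
  choose T hT using fun f => cauchySeq_tendsto_of_complete (hA.cauchySeq_approx t f)
  exact ⟨continuousLinearMapOfTendsto (hA.approx t) (tendsto_pi_nhds.2 hT), hT⟩

/-- The contraction semigroup generated by a nonpositive self-adjoint operator. -/
def semigroup (hA : IsDissipative A) (t : ℝ) : H →L[ℝ] H :=
  (hA.exists_tendsto_approx t).choose

theorem tendsto_approx (hA : IsDissipative A) (t : ℝ) (f : H) :
    Tendsto (fun n => hA.approx t n f) atTop (𝓝 (hA.semigroup t f)) :=
  (hA.exists_tendsto_approx t).choose_spec f

theorem norm_semigroup_apply_le (hA : IsDissipative A) (t : ℝ) (f : H) :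
    ‖hA.semigroup t f‖ ≤ ‖f‖ :=
  le_of_tendsto (hA.tendsto_approx t f).norm
    (Eventually.of_forall fun n => hA.norm_approx_apply_le t n f)

theorem inner_semigroup (hA : IsDissipative A) (t : ℝ) (f g : H) :
    inner ℝ (hA.semigroup t f) g = inner ℝ f (hA.semigroup t g) := by
  refine tendsto_nhds_unique ((hA.tendsto_approx t f).inner tendsto_const_nhds) ?_
  simp_rw [approx, inner_exp_smul (hA.inner_yosida Nat.one_div_pos_of_nat)]
  exact tendsto_const_nhds.inner (hA.tendsto_approx t g)

theorem semigroup_add_apply (hA : IsDissipative A) {s t : ℝ} (hs : 0 ≤ s) (ht : 0 ≤ t) (f : H) :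
    hA.semigroup (s + t) f = hA.semigroup s (hA.semigroup t f) := by
  refine tendsto_nhds_unique (hA.tendsto_approx (s + t) f) ?_
  have : ∀ n, hA.approx (s + t) n f = hA.approx s n (hA.approx t n f) := fun n => by
    rw [approx, approx, approx, max_eq_left hs, max_eq_left ht, max_eq_left (add_nonneg hs ht),
      exp_add_smul_apply]
  simp_rw [this]
  exact tendsto_apply_of_norm_le (hA.norm_approx_apply_le s) (hA.tendsto_approx t f)
    (hA.tendsto_approx s _)

theorem semigroup_zero_apply (hA : IsDissipative A) (f : H) : hA.semigroup 0 f = f :=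
  tendsto_nhds_unique (hA.tendsto_approx 0 f) (by simp [approx])

theorem norm_semigroup_fst_sub_le (hA : IsDissipative A) (t : ℝ) {p : H × H} (hp : p ∈ A) :
    ‖hA.semigroup t p.1 - p.1‖ ≤ max t 0 * ‖p.2‖ := by
  refine le_of_tendsto ((hA.tendsto_approx t p.1).sub_const p.1).norm
    (Eventually.of_forall fun n => ?_)
  refine (norm_exp_smul_sub_le (hA.inner_yosida_self_nonpos Nat.one_div_pos_of_nat)
    (le_max_right t 0) p.1).trans ?_
  gcongr
  exact hA.norm_yosida_fst_le Nat.one_div_pos_of_nat hp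

theorem tendsto_semigroup_zero (hA : IsDissipative A) (f : H) :
    Tendsto (fun t => hA.semigroup t f) (𝓝 0) (𝓝 f) := by
  rw [Metric.tendsto_nhds]
  intro ε hε
  obtain ⟨p, hp, hfp⟩ := hA.exists_mem_norm_sub_lt f (show 0 < ε / 4 by positivity)
  have hlim : Tendsto (fun t : ℝ => max t 0 * ‖p.2‖) (𝓝 0) (𝓝 0) := by
    have h : Continuous fun t : ℝ => max t 0 * ‖p.2‖ := by fun_prop
    simpa using h.tendsto 0
  filter_upwards [hlim.eventually_lt_const (show 0 < ε / 4 by positivity)] with t ht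
  rw [dist_eq_norm]
  have h1 : hA.semigroup t f - f =
      hA.semigroup t (f - p.1) + (hA.semigroup t p.1 - p.1) - (f - p.1) := by
    rw [map_sub]; abel
  rw [h1]
  have h2 := hA.norm_semigroup_apply_le t (f - p.1)
  have h3 := hA.norm_semigroup_fst_sub_le t hp
  have h4 := norm_sub_le (hA.semigroup t (f - p.1) + (hA.semigroup t p.1 - p.1)) (f - p.1)
  have h5 := norm_add_le (hA.semigroup t (f - p.1)) (hA.semigroup t p.1 - p.1)
  linarith

theorem semigroup_max (hA : IsDissipative A) (t : ℝ) :
    hA.semigroup (max t 0) = hA.semigroup t := by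
  ext f
  refine tendsto_nhds_unique (hA.tendsto_approx _ f) ?_
  have := hA.tendsto_approx t f
  simpa [approx] using this

theorem norm_semigroup_sub_le (hA : IsDissipative A) {s t : ℝ} (hs : 0 ≤ s) (ht : 0 ≤ t) (f : H) :
    ‖hA.semigroup t f - hA.semigroup s f‖ ≤ ‖hA.semigroup |t - s| f - f‖ := by
  wlog h : s ≤ t generalizing s t
  · rw [norm_sub_rev, abs_sub_comm]
    exact this ht hs (le_of_not_ge h)
  rw [abs_of_nonneg (sub_nonneg.2 h)]
  have : hA.semigroup t f = hA.semigroup s (hA.semigroup (t - s) f) := by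
    rw [← hA.semigroup_add_apply hs (sub_nonneg.2 h)]; congr 2; ring
  rw [this, ← map_sub]
  exact hA.norm_semigroup_apply_le _ _

theorem continuous_semigroup (hA : IsDissipative A) (f : H) :
    Continuous fun t => hA.semigroup t f := by
  rw [continuous_iff_continuousAt]
  intro s
  rw [ContinuousAt, tendsto_iff_norm_sub_tendsto_zero]
  have h1 : Tendsto (fun t : ℝ => |max t 0 - max s 0|) (𝓝 s) (𝓝 0) := by
    have : Continuous fun t : ℝ => |max t 0 - max s 0| := by fun_prop
    simpa using this.tendsto s
  have h2 := tendsto_iff_norm_sub_tendsto_zero.1 ((hA.tendsto_semigroup_zero f).comp h1)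
  refine squeeze_zero (fun _ => norm_nonneg _) (fun t => ?_) h2
  rw [← hA.semigroup_max t, ← hA.semigroup_max s]
  exact hA.norm_semigroup_sub_le (le_max_right _ _) (le_max_right _ _) f

/-- `A p` need not lie in the domain, so it is approximated by a domain vector `q`. For the Yosida
approximations `Y`, the velocity `e^{sY} Y p` then differs from `Y p` by at most `2 ‖Y p - q‖ + s ‖A
q‖`, and this bound passes to the limit. -/
theorem tendsto_slope_of_mem (hA : IsDissipative A) {p : H × H} (hp : p ∈ A) :
    Tendsto (fun t : ℝ => t⁻¹ • (hA.semigroup t p.1 - p.1)) (𝓝[>] 0) (𝓝 p.2) := by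
  rw [Metric.tendsto_nhds]
  intro ε hε
  obtain ⟨q, hq, hpq⟩ := hA.exists_mem_norm_sub_lt p.2 (show 0 < ε / 4 by positivity)
  have hlim : Tendsto (fun t : ℝ => t * ‖q.2‖) (𝓝[>] 0) (𝓝 0) := by
    have : Tendsto (fun c : ℝ => c * ‖q.2‖) (𝓝 0) (𝓝 (0 * ‖q.2‖)) := tendsto_id.mul_const _
    rw [zero_mul] at this
    exact this.mono_left nhdsWithin_le_nhds
  filter_upwards [self_mem_nhdsWithin, hlim.eventually_lt_const (show 0 < ε / 4 by positivity)]
    with t ht hq2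
  have ht0 : (0 : ℝ) < t := ht
  have key : ‖hA.semigroup t p.1 - p.1 - t • p.2‖ ≤ (2 * ‖p.2 - q.1‖ + t * ‖q.2‖) * t := by
    have hy := hA.tendsto_yosida_fst hp
    have hl : Tendsto (fun n : ℕ => hA.approx t n p.1 - p.1 -
        t • hA.yosida (1 / ((n : ℝ) + 1)) p.1) atTop
        (𝓝 (hA.semigroup t p.1 - p.1 - t • p.2)) :=
      ((hA.tendsto_approx t p.1).sub_const p.1).sub (hy.const_smul t)
    have hr : Tendsto (fun n : ℕ => (2 * ‖hA.yosida (1 / ((n : ℝ) + 1)) p.1 - q.1‖ +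
        t * ‖q.2‖) * t) atTop (𝓝 ((2 * ‖p.2 - q.1‖ + t * ‖q.2‖) * t)) :=
      (((hy.sub_const q.1).norm.const_mul 2).add_const _).mul_const t
    refine le_of_tendsto_of_tendsto' hl.norm hr fun n => ?_
    set Y := hA.yosida (1 / ((n : ℝ) + 1)) with hY
    have hneg : ∀ f, inner ℝ (Y f) f ≤ 0 := hA.inner_yosida_self_nonpos Nat.one_div_pos_of_nat
    rw [approx, max_eq_left ht0.le]
    refine norm_exp_smul_sub_sub_le Y ht0.le p.1 fun s hs => ?_
    have e1 := norm_exp_smul_apply_le hneg hs.1 (Y p.1 - q.1)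
    have e2 := norm_exp_smul_sub_le hneg hs.1 q.1
    have e3 : s * ‖Y q.1‖ ≤ t * ‖q.2‖ :=
      mul_le_mul hs.2.le (hA.norm_yosida_fst_le Nat.one_div_pos_of_nat hq) (norm_nonneg _) ht0.le
    have e4 : exp (s • Y) (Y p.1) - Y p.1 =
        exp (s • Y) (Y p.1 - q.1) + (exp (s • Y) q.1 - q.1) - (Y p.1 - q.1) := by
      rw [map_sub]; abel
    rw [e4]
    have e5 := norm_sub_le (exp (s • Y) (Y p.1 - q.1) + (exp (s • Y) q.1 - q.1)) (Y p.1 - q.1)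
    have e6 := norm_add_le (exp (s • Y) (Y p.1 - q.1)) (exp (s • Y) q.1 - q.1)
    linarith
  have e : t⁻¹ • (hA.semigroup t p.1 - p.1) - p.2 =
      t⁻¹ • (hA.semigroup t p.1 - p.1 - t • p.2) := by
    rw [smul_sub t⁻¹ _ (t • p.2), smul_smul, inv_mul_cancel₀ ht0.ne', one_smul]
  rw [dist_eq_norm, e, norm_smul, norm_inv, Real.norm_of_nonneg ht0.le, inv_mul_lt_iff₀ ht0]
  refine key.trans_lt ?_
  rw [mul_comm]
  gcongr
  linarith

/-- Maximality: `1 - A` is already onto, so it provides `p` in the graph with `p.1 - p.2 = u - w`.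
The generator sends `u - p.1` to itself, which its nonpositivity allows only for the zero vector. -/
theorem mem_of_tendsto_slope (hA : IsDissipative A) {u w : H}
    (h : Tendsto (fun t : ℝ => t⁻¹ • (hA.semigroup t u - u)) (𝓝[>] 0) (𝓝 w)) : (u, w) ∈ A := by
  obtain ⟨p, hp, hpu⟩ := hA.surj 1 one_pos (u - w)
  rw [one_smul] at hpu
  have h1 := h.sub (hA.tendsto_slope_of_mem hp)
  have h2 : Tendsto (fun t : ℝ => inner ℝ (t⁻¹ • (hA.semigroup t (u - p.1) - (u - p.1))) (u - p.1))
      (𝓝[>] 0) (𝓝 (inner ℝ (w - p.2) (u - p.1))) := by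
    refine Tendsto.inner (h1.congr fun t => ?_) tendsto_const_nhds
    rw [map_sub, ← smul_sub]; congr 1; abel
  have h3 : w - p.2 = u - p.1 := by
    rw [sub_eq_sub_iff_add_eq_add] at hpu ⊢
    rw [add_comm w, hpu]
  rw [h3, real_inner_self_eq_norm_sq] at h2
  have h4 : ‖u - p.1‖ ^ 2 ≤ 0 := by
    refine le_of_tendsto h2 ?_
    filter_upwards [self_mem_nhdsWithin] with t ht
    rw [real_inner_smul_left, inner_sub_left, real_inner_self_eq_norm_sq]
    refine mul_nonpos_of_nonneg_of_nonpos (inv_nonneg.2 (le_of_lt ht)) ?_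
    have := real_inner_le_norm (hA.semigroup t (u - p.1)) (u - p.1)
    have := hA.norm_semigroup_apply_le t (u - p.1)
    nlinarith [norm_nonneg (u - p.1)]
  have h5 : u - p.1 = 0 := by
    rw [← norm_eq_zero]; nlinarith [norm_nonneg (u - p.1)]
  rw [h5] at h3
  rw [sub_eq_zero.1 h5, sub_eq_zero.1 h3]
  exact hp

/-- The Yosida approximation is `c⁻¹ (J_c - 1)`, so its exponential is the positive scalar
`e^{-t/c}` times `e^{(t/c) J_c}`, which preserves any closed cone that `J_c` preserves. -/
theorem semigroup_mem (hA : IsDissipative A) {C : Set H} (hC : IsClosed C) (h0 : (0 : H) ∈ C)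
    (hadd : ∀ f ∈ C, ∀ g ∈ C, f + g ∈ C) (hsmul : ∀ a : ℝ, 0 ≤ a → ∀ f ∈ C, a • f ∈ C)
    (hR : ∀ c : ℝ, 0 < c → ∀ f ∈ C, hA.resolvent c f ∈ C) (t : ℝ) {f : H} (hf : f ∈ C) :
    hA.semigroup t f ∈ C := by
  refine hC.mem_of_tendsto (hA.tendsto_approx t f) (Eventually.of_forall fun n => ?_)
  set c : ℝ := 1 / ((n : ℝ) + 1) with hc
  have hc0 : 0 < c := Nat.one_div_pos_of_nat
  have hsplit : max t 0 • hA.yosida c =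
      (-(max t 0 * c⁻¹)) • (1 : H →L[ℝ] H) + (max t 0 * c⁻¹) • hA.resolvent c := by
    rw [yosida, smul_smul, smul_sub, neg_smul]; abel
  have hexp1 : exp ((-(max t 0 * c⁻¹)) • (1 : H →L[ℝ] H)) =
      Real.exp (-(max t 0 * c⁻¹)) • (1 : H →L[ℝ] H) := by
    rw [← Algebra.algebraMap_eq_smul_one, ← Algebra.algebraMap_eq_smul_one,
      ← NormedSpace.algebraMap_exp_comm, Real.exp_eq_exp_ℝ]
  let _ := NormedAlgebra.restrictScalars ℚ ℝ (H →L[ℝ] H)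
  rw [approx, hsplit, NormedSpace.exp_add_of_commute
    (((Commute.one_left _).smul_left _).smul_right _), hexp1]
  change Real.exp _ • exp ((max t 0 * c⁻¹) • hA.resolvent c) f ∈ C
  exact hsmul _ (Real.exp_pos _).le _
    (exp_smul_mem hC h0 hadd hsmul (hR c hc0) (by positivity) hf)

theorem semigroup_apply_of_mem_zero (hA : IsDissipative A) {f : H} (hf : (f, (0 : H)) ∈ A) (t : ℝ) :
    hA.semigroup t f = f := by
  have := hA.norm_semigroup_fst_sub_le t hf
  simpa [sub_eq_zero] using this

/-- The discrete ergodic theorem only yields fixed points of `T_1`. For `0 < t < 1`, contractivity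
gives `‖T_{t/2} f‖ = ‖f‖`, and by symmetry `⟨T_t f, f⟩ = ‖T_{t/2} f‖²`, so `T_t f = f`. -/
theorem mem_zero_of_semigroup_one (hA : IsDissipative A) {f : H} (hf : hA.semigroup 1 f = f) :
    (f, (0 : H)) ∈ A := by
  refine hA.mem_of_tendsto_slope (tendsto_const_nhds.congr' ?_)
  filter_upwards [Ioo_mem_nhdsGT one_pos] with t ht
  have h1 : ‖f‖ ≤ ‖hA.semigroup (t / 2) f‖ := by
    have e : hA.semigroup 1 f = hA.semigroup (1 - t / 2) (hA.semigroup (t / 2) f) := by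
      rw [← hA.semigroup_add_apply (by linarith [ht.2]) (by linarith [ht.1])]; congr 2; ring
    rw [hf] at e
    conv_lhs => rw [e]
    exact hA.norm_semigroup_apply_le _ _
  have h2 : inner ℝ (hA.semigroup t f) f = ‖hA.semigroup (t / 2) f‖ ^ 2 := by
    rw [← real_inner_self_eq_norm_sq, hA.inner_semigroup (t / 2) f, ← hA.semigroup_add_apply
      (by linarith [ht.1]) (by linarith [ht.1]), real_inner_comm]
    congr 3; ring
  have h3 := norm_sub_sq_real (hA.semigroup t f) f
  rw [h2] at h3
  have h4 := hA.norm_semigroup_apply_le t f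
  have h5 : ‖hA.semigroup t f - f‖ ^ 2 ≤ 0 := by
    nlinarith [norm_nonneg f, norm_nonneg (hA.semigroup t f)]
  have h6 : hA.semigroup t f - f = 0 := by
    rw [← norm_eq_zero]; nlinarith [norm_nonneg (hA.semigroup t f - f)]
  rw [h6, smul_zero]

end IsDissipative

end Semigroup

/-! ### Pairings in `L²` -/

section L2

variable {α : Type*} [MeasurableSpace α] {μ : Measure α}

theorem inner_Lp_eq_integral (f g : Lp ℝ 2 μ) : inner ℝ f g = ∫ x, f x * g x ∂μ := by
  rw [L2.inner_def]
  exact integral_congr_ae (ae_of_all _ fun x => by simp [mul_comm])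

theorem inner_toLp_eq_integral {f g : α → ℝ} (hf : MemLp f 2 μ) (hg : MemLp g 2 μ) :
    inner ℝ (hf.toLp f) (hg.toLp g) = ∫ x, f x * g x ∂μ := by
  rw [inner_Lp_eq_integral]
  refine integral_congr_ae ?_
  filter_upwards [hf.coeFn_toLp, hg.coeFn_toLp] with x h1 h2
  rw [h1, h2]

theorem abs_integral_mul_le {f g : α → ℝ} (hf : MemLp f 2 μ) (hg : MemLp g 2 μ) :
    |∫ x, f x * g x ∂μ| ≤ (eLpNorm f 2 μ).toReal * (eLpNorm g 2 μ).toReal := by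
  rw [← inner_toLp_eq_integral hf hg, ← Lp.norm_toLp f hf, ← Lp.norm_toLp g hg]
  exact abs_real_inner_le_norm _ _

end L2

/-! ### Test functions and duality in `L²(U)` -/

section TestFunctions

variable {E : Type*} [NormedAddCommGroup E] [NormedSpace ℝ E]

/-- The space of smooth functions with compact support in `U`. -/
def testFunctions (U : Set E) : Submodule ℝ (E → ℝ) where
  carrier := {φ | ContDiff ℝ ∞ φ ∧ HasCompactSupport φ ∧ tsupport φ ⊆ U}
  add_mem' := fun {φ ψ} hφ hψ => ⟨hφ.1.add hψ.1, hφ.2.1.add hψ.2.1,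
    (tsupport_add φ ψ).trans (union_subset hφ.2.2 hψ.2.2)⟩
  zero_mem' := ⟨contDiff_const, HasCompactSupport.zero, by simp [tsupport]⟩
  smul_mem' := fun c φ hφ => ⟨contDiff_const.smul hφ.1, hφ.2.1.smul_left,
    (closure_mono (Function.support_const_smul_subset c φ)).trans hφ.2.2⟩

theorem continuous_fderiv_apply {φ : E → ℝ} (hφ : ContDiff ℝ ∞ φ) (h : E) :
    Continuous fun x => fderiv ℝ φ x h :=
  (hφ.continuous_fderiv (by simp)).clm_apply continuous_const

theorem hasCompactSupport_fderiv_apply {φ : E → ℝ} (hφ : HasCompactSupport φ) (h : E) :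
    HasCompactSupport fun x => fderiv ℝ φ x h :=
  hφ.fderiv_apply (𝕜 := ℝ) h

theorem fderiv_apply_eq_zero_of_notMem_tsupport {φ : E → ℝ} {x : E} (hx : x ∉ tsupport φ) (h : E) :
    fderiv ℝ φ x h = 0 := by
  have : fderiv ℝ φ x = 0 := by
    by_contra hne
    exact hx (tsupport_fderiv_subset ℝ (subset_tsupport _ hne))
  rw [this]; rfl

theorem comp_sub_mem_testFunctions {V K : Set E} {φ : E → ℝ} (hφ : φ ∈ testFunctions V) {a : E}
    (hVK : ∀ x ∈ V, x + a ∈ K) : (fun x => φ (x - a)) ∈ testFunctions K := by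
  refine ⟨hφ.1.comp (contDiff_id.sub contDiff_const), ?_, ?_⟩
  · exact hφ.2.1.comp_homeomorph (Homeomorph.subRight a)
  · intro x hx
    have h1 := tsupport_comp_subset_preimage φ (f := fun x => x - a) (by fun_prop) hx
    simpa using hVK _ (hφ.2.2 h1)

variable [MeasurableSpace E] [BorelSpace E] {μ : Measure E}

theorem memLp_of_mem_testFunctions [IsFiniteMeasureOnCompacts μ] {U : Set E} {φ : E → ℝ}
    (hφ : φ ∈ testFunctions U) (V : Set E) (p : ℝ≥0∞) : MemLp φ p (μ.restrict V) :=
  (hφ.1.continuous.memLp_of_hasCompactSupport hφ.2.1).restrict V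

variable (μ) in
/-- The inclusion of the test functions into `L²(U)`. -/
def testToLp [IsFiniteMeasureOnCompacts μ] (U : Set E) :
    testFunctions U →ₗ[ℝ] Lp ℝ 2 (μ.restrict U) where
  toFun φ := (memLp_of_mem_testFunctions (μ := μ) φ.2 U 2).toLp φ
  map_add' _ _ := rfl
  map_smul' _ _ := rfl

theorem inner_testToLp [IsFiniteMeasureOnCompacts μ] {U : Set E} (f : Lp ℝ 2 (μ.restrict U))
    (φ : testFunctions U) : inner ℝ f (testToLp μ U φ) = ∫ x in U, f x * (φ : E → ℝ) x ∂μ := by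
  rw [inner_Lp_eq_integral]
  refine integral_congr_ae ?_
  filter_upwards [(memLp_of_mem_testFunctions (μ := μ) φ.2 U 2).coeFn_toLp] with x h1
  exact congrArg _ h1

theorem norm_testToLp [IsFiniteMeasureOnCompacts μ] {U : Set E} (φ : testFunctions U) :
    ‖testToLp μ U φ‖ = (eLpNorm (φ : E → ℝ) 2 μ).toReal := by
  have h1 : ‖testToLp μ U φ‖ = (eLpNorm (φ : E → ℝ) 2 (μ.restrict U)).toReal :=
    Lp.norm_toLp _ (memLp_of_mem_testFunctions (μ := μ) φ.2 U 2)
  rw [h1, eLpNorm_restrict_eq_of_support_subset ((subset_tsupport _).trans φ.2.2.2)]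

variable [FiniteDimensional ℝ E] [μ.IsAddHaarMeasure]

theorem eq_zero_of_integral_mul_eq_zero {U : Set E} (hU : IsOpen U) (f : Lp ℝ 2 (μ.restrict U))
    (h : ∀ φ ∈ testFunctions U, ∫ x in U, f x * φ x ∂μ = 0) : f = 0 := by
  rw [Lp.eq_zero_iff_ae_eq_zero]
  have hloc : LocallyIntegrableOn f U (μ.restrict U) :=
    ((Lp.memLp f).locallyIntegrable one_le_two).locallyIntegrableOn U
  have := hU.ae_eq_zero_of_integral_contDiff_smul_eq_zero hloc fun φ h1 h2 h3 => by
    rw [← h φ ⟨h1, h2, h3⟩]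
    exact integral_congr_ae (ae_of_all _ fun x => by simp [mul_comm])
  filter_upwards [this, ae_restrict_mem hU.measurableSet] with x h1 h2
  exact h1 h2

/-- By the fundamental lemma of the calculus of variations, the orthogonal complement is trivial. -/
theorem denseRange_testToLp {U : Set E} (hU : IsOpen U) : DenseRange (testToLp μ U) := by
  change Dense (range (testToLp μ U))
  rw [← LinearMap.coe_range, Submodule.dense_iff_topologicalClosure_eq_top,
    Submodule.topologicalClosure_eq_top_iff, Submodule.eq_bot_iff]
  intro f hf
  refine eq_zero_of_integral_mul_eq_zero hU f fun φ hφ => ?_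
  rw [← inner_testToLp f ⟨φ, hφ⟩]
  exact (Submodule.mem_orthogonal' _ _).1 hf _ (LinearMap.mem_range_self _ _)

theorem eq_of_integral_mul_eq {U : Set E} (hU : IsOpen U) {f g : Lp ℝ 2 (μ.restrict U)}
    (h : ∀ φ ∈ testFunctions U, ∫ x in U, f x * φ x ∂μ = ∫ x in U, g x * φ x ∂μ) : f = g := by
  refine (denseRange_testToLp (μ := μ) hU).eq_of_inner_right ℝ fun φ => ?_
  rw [real_inner_comm, inner_testToLp, real_inner_comm, inner_testToLp, h φ φ.2]

/-- A linear functional on test functions that is bounded in `L²(U)` is given by an element of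
`L²(U)`. -/
theorem exists_eq_integral_of_norm_le {U : Set E} (hU : IsOpen U) (L : testFunctions U →ₗ[ℝ] ℝ)
    {C : ℝ} (hC : 0 ≤ C) (hL : ∀ φ, |L φ| ≤ C * ‖testToLp μ U φ‖) :
    ∃ g : Lp ℝ 2 (μ.restrict U), ‖g‖ ≤ C ∧
      ∀ φ : testFunctions U, L φ = ∫ x in U, g x * (φ : E → ℝ) x ∂μ := by
  have hd := denseRange_testToLp (μ := μ) hU
  refine ⟨(InnerProductSpace.toDual ℝ _).symm (L.extendOfNorm (testToLp μ U)), ?_, fun φ => ?_⟩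
  · rw [LinearIsometryEquiv.norm_map]
    exact LinearMap.opNorm_extendOfNorm_le hd hC hL
  · rw [← inner_testToLp, InnerProductSpace.toDual_symm_apply,
      LinearMap.extendOfNorm_eq hd ⟨C, hL⟩]

/-- The bound extends by density from test functions to all of `L²(U)`, where `f` itself can be
inserted. -/
theorem norm_le_of_abs_integral_le {U : Set E} (hU : IsOpen U) {f : E → ℝ}
    (hf : MemLp f 2 (μ.restrict U)) {C : ℝ} (hC : 0 ≤ C)
    (h : ∀ φ ∈ testFunctions U, |∫ x in U, f x * φ x ∂μ| ≤ C * (eLpNorm φ 2 μ).toReal) :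
    (eLpNorm f 2 (μ.restrict U)).toReal ≤ C := by
  rw [← Lp.norm_toLp f hf]
  set F := hf.toLp f
  have key : ∀ g : Lp ℝ 2 (μ.restrict U), |inner ℝ F g| ≤ C * ‖g‖ := by
    intro g
    refine (denseRange_testToLp (μ := μ) hU).induction_on g ?_ fun φ => ?_
    · exact isClosed_le (by fun_prop) (by fun_prop)
    · rw [inner_testToLp, norm_testToLp]
      convert h φ φ.2 using 2
      refine integral_congr_ae ?_
      filter_upwards [hf.coeFn_toLp] with x hx
      rw [hx]
  have h1 := key F
  rw [real_inner_self_eq_norm_sq, abs_of_nonneg (by positivity), sq] at h1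
  rcases (norm_nonneg F).eq_or_lt with h0 | h0
  · rw [← h0]; exact hC
  · exact le_of_mul_le_mul_right h1 h0

end TestFunctions

/-! ### Localization and translation of integrals -/

section Integrals

variable {α : Type*} [MeasurableSpace α] {μ : Measure α}

theorem integrable_indicator_of_memLp {K : Set α} (hK : MeasurableSet K) (hKf : μ K ≠ ⊤) {u : α → ℝ}
    (hu : MemLp u 2 (μ.restrict K)) : Integrable (K.indicator u) μ := by
  have : IsFiniteMeasure (μ.restrict K) := ⟨by simpa using hKf.lt_top⟩
  rw [integrable_indicator_iff hK]
  exact hu.integrable one_le_two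

theorem setIntegral_eq_of_support_subset [TopologicalSpace α] {V : Set α} {f φ : α → ℝ} (hφ : tsupport φ ⊆ V) :
    ∫ x in V, f x * φ x ∂μ = ∫ x, f x * φ x ∂μ :=
  setIntegral_eq_integral_of_forall_compl_eq_zero fun x hx => by
    rw [image_eq_zero_of_notMem_tsupport fun h => hx (hφ h), mul_zero]

theorem integral_indicator_mul_eq {K D : Set α} (hKD : K ⊆ D) {u ψ : α → ℝ}
    (hψ : ∀ x ∉ K, ψ x = 0) : ∫ x, K.indicator u x * ψ x ∂μ = ∫ x in D, u x * ψ x ∂μ := by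
  rw [setIntegral_eq_integral_of_forall_compl_eq_zero fun x hx => by
    rw [hψ x fun h => hx (hKD h), mul_zero]]
  refine integral_congr_ae (ae_of_all _ fun x => ?_)
  by_cases hx : x ∈ K
  · simp [hx]
  · simp [hψ x hx]

/-- Moves a translation from a rough function to the test function, where it can be differentiated.
-/
theorem integral_sub_mul_eq {G : Type*} [NormedAddCommGroup G]
    [MeasurableSpace G] [BorelSpace G] {μ : Measure G} [μ.IsAddRightInvariant] {u φ : G → ℝ} (hu : Integrable u μ)
    (hφ : Continuous φ) (hφc : HasCompactSupport φ) (a : G) :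
    ∫ x, (u (x + a) - u x) * φ x ∂μ = ∫ x, u x * φ (x - a) ∂μ - ∫ x, u x * φ x ∂μ := by
  obtain ⟨C, hC⟩ := hφc.exists_bound_of_continuous hφ
  have h1 : Integrable (fun x => u (x + a) * φ x) μ :=
    (hu.comp_add_right a).mul_bdd (c := C) hφ.aestronglyMeasurable (ae_of_all _ hC)
  have h2 : Integrable (fun x => u x * φ x) μ :=
    hu.mul_bdd (c := C) hφ.aestronglyMeasurable (ae_of_all _ hC)
  simp_rw [sub_mul]
  rw [integral_sub h1 h2]
  congr 1
  rw [← integral_add_right_eq_self (fun x => u x * φ (x - a)) a]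
  simp

end Integrals

/-! ### The translation estimate and normal contractions -/

section Translation

variable {E : Type*} [NormedAddCommGroup E] [NormedSpace ℝ E] [MeasurableSpace E]
  {μ : Measure E}

/-- `g` is the distributional derivative of `u` on `D` in the direction `h`. -/
def HasWeakDeriv (μ : Measure E) (D : Set E) (h : E) (u g : E → ℝ) : Prop :=
  ∀ φ ∈ testFunctions D, ∫ x in D, u x * fderiv ℝ φ x h ∂μ = -∫ x in D, g x * φ x ∂μ

theorem HasWeakDeriv.smul_direction {D : Set E} {h : E} {u g : E → ℝ} (hw : HasWeakDeriv μ D h u g)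
    (s : ℝ) : HasWeakDeriv μ D (s • h) u (fun x => s * g x) := by
  intro φ hφ
  have := hw φ hφ
  simp only [map_smul, smul_eq_mul, mul_left_comm _ s, mul_assoc, integral_const_mul]
  rw [this]; ring

variable [BorelSpace E]

theorem integrable_mul_of_tsupport_subset [FiniteDimensional ℝ E] [IsFiniteMeasureOnCompacts μ]
    {D : Set E} {u ψ : E → ℝ}
    (hu : ∀ K ⊆ D, IsCompact K → MemLp u 2 (μ.restrict K)) (hψ : Continuous ψ)
    (hψc : HasCompactSupport ψ) (hψD : tsupport ψ ⊆ D) : Integrable (fun x => u x * ψ x) μ := by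
  rw [← integrableOn_iff_integrable_of_support_subset (s := tsupport ψ)]
  · exact (hu _ hψD hψc).integrable_mul (q := 2) ((hψ.memLp_of_hasCompactSupport hψc).restrict _)
  · intro x hx
    exact subset_tsupport _ (right_ne_zero_of_mul hx)

/-- The derivative falls on `φ` alone, so integrability of `u` suffices: the integrands are
dominated by `|u|` times the supremum of the directional derivative of `φ`. -/
theorem hasDerivAt_integral_mul_comp_sub {u φ : E → ℝ} (hu : Integrable u μ)
    (hφ : ContDiff ℝ ∞ φ) (hφc : HasCompactSupport φ) (h : E) (t : ℝ) :
    HasDerivAt (fun t : ℝ => ∫ x, u x * φ (x - t • h) ∂μ)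
      (-∫ x, u x * fderiv ℝ φ (x - t • h) h ∂μ) t := by
  obtain ⟨C, hC⟩ := (hasCompactSupport_fderiv_apply hφc h).exists_bound_of_continuous
    (continuous_fderiv_apply hφ h)
  obtain ⟨C₀, hC₀⟩ := hφc.exists_bound_of_continuous hφ.continuous
  have hm : ∀ s : ℝ, Continuous fun x => φ (x - s • h) := fun s =>
    hφ.continuous.comp (by fun_prop)
  have hm' : ∀ s : ℝ, Continuous fun x => fderiv ℝ φ (x - s • h) h := fun s =>
    (continuous_fderiv_apply hφ h).comp (by fun_prop)
  have := (hasDerivAt_integral_of_dominated_loc_of_deriv_le (μ := μ) (x₀ := t)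
    (F := fun (t : ℝ) x => u x * φ (x - t • h))
    (F' := fun (t : ℝ) x => u x * -(fderiv ℝ φ (x - t • h) h))
    (bound := fun x => ‖u x‖ * C) univ_mem
    (Eventually.of_forall fun s => hu.1.mul (hm s).aestronglyMeasurable)
    (hu.mul_bdd (c := C₀) (hm t).aestronglyMeasurable (ae_of_all _ fun x => hC₀ _))
    (hu.1.mul (hm' t).neg.aestronglyMeasurable)
    (ae_of_all _ fun x s _ => by
      rw [norm_mul, norm_neg]
      exact mul_le_mul_of_nonneg_left (hC _) (norm_nonneg _))
    (hu.norm.mul_const C)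
    (ae_of_all _ fun x s _ => ?_)).2
  · simpa [integral_neg] using this
  · have h1 : HasDerivAt (fun s : ℝ => x - s • h) (-h) s := by
      simpa using ((hasDerivAt_id s).smul_const h).const_sub x
    have h2 := ((hφ.differentiable (by simp)) (x - s • h)).hasFDerivAt.comp_hasDerivAt s h1
    simpa using h2.const_mul (u x)

variable [FiniteDimensional ℝ E] [μ.IsAddHaarMeasure]

/-- The translation estimate for functions with a distributional derivative in `L²(D)`. -/
theorem eLpNorm_translate_sub_le {D K V : Set E} (hK : IsCompact K) (hKD : K ⊆ D) (hV : IsOpen V)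
    {h : E} (hVK : ∀ x ∈ V, ∀ t ∈ Icc (0 : ℝ) 1, x + t • h ∈ K) {u g : E → ℝ}
    (hu : MemLp u 2 (μ.restrict K)) (hg : MemLp g 2 (μ.restrict D)) (hw : HasWeakDeriv μ D h u g) :
    eLpNorm (fun x => u (x + h) - u x) 2 (μ.restrict V) ≤ eLpNorm g 2 (μ.restrict D) := by
  set v : E → ℝ := K.indicator u with hv
  have hvi : Integrable v μ := integrable_indicator_of_memLp hK.measurableSet hK.measure_lt_top.ne hu
  have hv2 : MemLp v 2 μ := (memLp_indicator_iff_restrict hK.measurableSet).2 hu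
  have hcongr : (fun x => u (x + h) - u x) =ᵐ[μ.restrict V] fun x => v (x + h) - v x := by
    filter_upwards [ae_restrict_mem hV.measurableSet] with x hx
    have h1 : x + h ∈ K := by simpa using hVK x hx 1 (by simp)
    have h0 : x ∈ K := by simpa using hVK x hx 0 (by simp)
    simp [hv, h1, h0]
  have hf : MemLp (fun x => v (x + h) - v x) 2 (μ.restrict V) :=
    ((hv2.comp_measurePreserving (measurePreserving_add_right μ h)).sub hv2).restrict V
  rw [eLpNorm_congr_ae hcongr, ← ENNReal.toReal_le_toReal hf.eLpNorm_ne_top hg.eLpNorm_ne_top]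
  refine norm_le_of_abs_integral_le hV hf ENNReal.toReal_nonneg fun φ hφ => ?_
  rw [setIntegral_eq_of_support_subset hφ.2.2,
    integral_sub_mul_eq hvi hφ.1.continuous hφ.2.1]
  -- After the translation is moved to `φ`, the pairing is the increment over `[0, 1]` of `t ↦ ∫ v
  -- φ(· - t h)`, so it is enough to bound the derivative in `t`.
  have hb := norm_image_sub_le_of_norm_deriv_le_segment_01'
    (C := (eLpNorm g 2 (μ.restrict D)).toReal * (eLpNorm φ 2 μ).toReal)
    (fun t _ => (hasDerivAt_integral_mul_comp_sub (μ := μ) hvi hφ.1 hφ.2.1 h t).hasDerivWithinAt)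
    (fun t ht => ?_)
  · simpa using hb
  -- The translated test function is still supported in `K ⊆ D`, so the weak derivative of `u` may
  -- be tested against it.
  · have hφt : (fun x => φ (x - t • h)) ∈ testFunctions K :=
      comp_sub_mem_testFunctions hφ fun x hx => hVK x hx t ⟨ht.1, ht.2.le⟩
    have e1 : ∫ x, v x * fderiv ℝ φ (x - t • h) h ∂μ =
        ∫ x in D, u x * fderiv ℝ (fun x => φ (x - t • h)) x h ∂μ := by
      simp_rw [fderiv_comp_sub]
      refine integral_indicator_mul_eq hKD fun x hx => ?_
      rw [← fderiv_comp_sub (f := φ)]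
      exact fderiv_apply_eq_zero_of_notMem_tsupport (fun h' => hx (hφt.2.2 h')) h
    rw [e1, hw _ ⟨hφt.1, hφt.2.1, hφt.2.2.trans hKD⟩, neg_neg, Real.norm_eq_abs]
    refine (abs_integral_mul_le hg (memLp_of_mem_testFunctions hφt D 2)).trans ?_
    gcongr
    · exact ((hφ.1.continuous.memLp_of_hasCompactSupport hφ.2.1)).eLpNorm_ne_top
    · refine (eLpNorm_mono_measure _ Measure.restrict_le_self).trans (le_of_eq ?_)
      simp_rw [sub_eq_add_neg]
      exact eLpNorm_comp_measurePreserving hφ.1.continuous.aestronglyMeasurable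
        (measurePreserving_add_right μ (-(t • h)))

/-- A normal contraction of a function with a distributional derivative in `L²(D)` has one as well,
of no larger norm. -/
theorem HasWeakDeriv.comp_lipschitz {D : Set E} (hD : IsOpen D) {h : E} {u : E → ℝ}
    {g : Lp ℝ 2 (μ.restrict D)} (hu : ∀ K ⊆ D, IsCompact K → MemLp u 2 (μ.restrict K))
    (hw : HasWeakDeriv μ D h u g) {N : ℝ → ℝ} (hN : LipschitzWith 1 N) (hN0 : N 0 = 0) :
    ∃ g' : Lp ℝ 2 (μ.restrict D), ‖g'‖ ≤ ‖g‖ ∧ HasWeakDeriv μ D h (N ∘ u) g' := by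
  have hNu : ∀ K ⊆ D, IsCompact K → MemLp (N ∘ u) 2 (μ.restrict K) := fun K hKD hK =>
    hN.comp_memLp hN0 (hu K hKD hK)
  have hint : ∀ φ : testFunctions D,
      Integrable (fun x => (N ∘ u) x * fderiv ℝ (φ : E → ℝ) x h) (μ.restrict D) := fun φ =>
    (integrable_mul_of_tsupport_subset hNu (continuous_fderiv_apply φ.2.1 h)
      (hasCompactSupport_fderiv_apply φ.2.2.1 h)
      ((tsupport_fderiv_apply_subset ℝ h).trans φ.2.2.2)).restrict
  -- The functional that the sought derivative has to represent; its `L²` bound is the whole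
  -- content.
  let L : testFunctions D →ₗ[ℝ] ℝ :=
    { toFun := fun φ => -∫ x in D, (N ∘ u) x * fderiv ℝ (φ : E → ℝ) x h ∂μ
      map_add' := fun φ ψ => by
        rw [← neg_add, ← integral_add (hint φ) (hint ψ)]
        congr 2
        ext x
        rw [← mul_add, Submodule.coe_add, fderiv_add
          (φ.2.1.differentiable (by simp) x) (ψ.2.1.differentiable (by simp) x)]
        rfl
      map_smul' := fun c φ => by
        rw [RingHom.id_apply, smul_eq_mul, mul_neg, ← integral_const_mul]
        congr 2
        ext x
        rw [Submodule.coe_smul, fderiv_const_smul (φ.2.1.differentiable (by simp) x)]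
        simp; ring }
  have hL : ∀ φ, |L φ| ≤ ‖g‖ * ‖testToLp μ D φ‖ := by
    rintro ⟨φ, hφ⟩
    rw [norm_testToLp]
    -- The compact set `K` leaves room to translate `V`, the half as thick neighbourhood of the
    -- support, by any vector shorter than `δ / 2`.
    obtain ⟨δ, hδ, hδD⟩ := hφ.2.1.isCompact.exists_cthickening_subset_open hD hφ.2.2
    set K := Metric.cthickening δ (tsupport φ) with hKdef
    have hK : IsCompact K := hφ.2.1.isCompact.cthickening
    set V := Metric.thickening (δ / 2) (tsupport φ) with hVdef
    have hV : IsOpen V := Metric.isOpen_thickening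
    have hφV : tsupport φ ⊆ V := Metric.self_subset_thickening (by positivity) _
    have hφK : tsupport φ ⊆ K := Metric.self_subset_cthickening _
    set v : E → ℝ := K.indicator (N ∘ u) with hv
    have hvi : Integrable v μ :=
      integrable_indicator_of_memLp hK.measurableSet hK.measure_lt_top.ne (hNu K hδD hK)
    have hv2 : MemLp v 2 μ := (memLp_indicator_iff_restrict hK.measurableSet).2 (hNu K hδD hK)
    have hder := hasDerivAt_integral_mul_comp_sub (μ := μ) hvi hφ.1 hφ.2.1 h 0
    have e1 : -∫ x, v x * fderiv ℝ φ (x - (0 : ℝ) • h) h ∂μ = L ⟨φ, hφ⟩ := by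
      simp only [zero_smul, sub_zero]
      change _ = -_
      rw [integral_indicator_mul_eq hδD fun x hx =>
        fderiv_apply_eq_zero_of_notMem_tsupport (fun h' => hx (hφK h')) h]
    rw [e1] at hder
    -- `L φ` is the derivative at `0` of the translated pairing, so a bound on its increments linear
    -- in `|s|` suffices. This turns the problem into one about differences.
    refine hder.le_of_lip' (by positivity) ?_
    have hsmall : ∀ᶠ s : ℝ in 𝓝 0, ‖s • h‖ < δ / 2 := by
      have : Tendsto (fun s : ℝ => ‖s • h‖) (𝓝 0) (𝓝 0) := by
        have : Continuous fun s : ℝ => ‖s • h‖ := by fun_prop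
        simpa using this.tendsto 0
      exact this.eventually_lt_const (by positivity)
    filter_upwards [hsmall] with s hs
    have hVK : ∀ x ∈ V, ∀ t ∈ Icc (0 : ℝ) 1, x + t • (s • h) ∈ K := by
      intro x hx t ht
      obtain ⟨z, hz, hxz⟩ := Metric.mem_thickening_iff.1 hx
      refine Metric.mem_cthickening_of_dist_le _ z _ _ hz ?_
      have h1 : dist (x + t • (s • h)) x ≤ ‖s • h‖ := by
        rw [dist_eq_norm, add_sub_cancel_left, norm_smul, Real.norm_of_nonneg ht.1]
        exact mul_le_of_le_one_left (norm_nonneg _) ht.2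
      linarith [dist_triangle (x + t • (s • h)) x z]
    have e2 := integral_sub_mul_eq (μ := μ) hvi hφ.1.continuous hφ.2.1 (s • h)
    have hgs : MemLp (fun x => s * g x) 2 (μ.restrict D) := (Lp.memLp g).const_mul s
    have e3 := eLpNorm_translate_sub_le hK hδD hV hVK (hu K hδD hK) hgs (hw.smul_direction s)
    have hf : MemLp (fun x => v (x + s • h) - v x) 2 (μ.restrict V) :=
      ((hv2.comp_measurePreserving (measurePreserving_add_right μ (s • h))).sub hv2).restrict V
    -- The only use of the contraction property: `N` does not increase pointwise differences.
    have e4 : eLpNorm (fun x => v (x + s • h) - v x) 2 (μ.restrict V) ≤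
        eLpNorm (fun x => u (x + s • h) - u x) 2 (μ.restrict V) := by
      refine eLpNorm_mono_ae ?_
      filter_upwards [ae_restrict_mem hV.measurableSet] with x hx
      have h1 : x + s • h ∈ K := by simpa using hVK x hx 1 (by simp)
      have h0 : x ∈ K := by simpa using hVK x hx 0 (by simp)
      simp only [hv, h1, h0, indicator_of_mem, Function.comp_apply]
      simpa using hN.norm_sub_le (u (x + s • h)) (u x)
    have e5 : (eLpNorm (fun x => s * g x) 2 (μ.restrict D)).toReal = |s| * ‖g‖ := by
      have := eLpNorm_const_smul (c := s) (f := g) (p := 2) (μ := μ.restrict D)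
      have h' : (fun x => s * g x) = s • (g : E → ℝ) := rfl
      rw [h', this, ENNReal.toReal_mul, Lp.norm_def]; simp
    simp only [zero_smul, sub_zero, Real.norm_eq_abs]
    rw [← e2, ← setIntegral_eq_of_support_subset (μ := μ) hφV]
    refine (abs_integral_mul_le hf (memLp_of_mem_testFunctions hφ V 2)).trans ?_
    have e6 : (eLpNorm (fun x => v (x + s • h) - v x) 2 (μ.restrict V)).toReal ≤ |s| * ‖g‖ := by
      rw [← e5]
      exact ENNReal.toReal_mono hgs.eLpNorm_ne_top (e4.trans e3)
    rw [eLpNorm_restrict_eq_of_support_subset ((subset_tsupport _).trans hφV)]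
    calc _ ≤ |s| * ‖g‖ * (eLpNorm φ 2 μ).toReal := by gcongr
      _ = _ := by ring
  obtain ⟨g', hg', hLg⟩ := exists_eq_integral_of_norm_le hD L (norm_nonneg g) hL
  refine ⟨g', hg', fun φ hφ => ?_⟩
  rw [← hLg ⟨φ, hφ⟩]
  exact (neg_neg _).symm

end Translation

/-! ### From weak to strong convergence -/

section Hilbert

variable {H : Type*} [NormedAddCommGroup H] [InnerProductSpace ℝ H]

/-- Convergence tested against a dense set, together with a bound by the norm of the limit, implies
strong convergence. -/
theorem tendsto_of_tendsto_inner_of_norm_le {S : Set H} (hS : Dense S) {g : ℕ → H} {g₀ : H}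
    (hg : ∀ n, ‖g n‖ ≤ ‖g₀‖) (h : ∀ f ∈ S, Tendsto (fun n => inner ℝ (g n) f) atTop
      (𝓝 (inner ℝ g₀ f))) : Tendsto g atTop (𝓝 g₀) := by
  rw [Metric.tendsto_atTop]
  intro ε hε
  -- Since `‖g n - g₀‖ ≤ 2 ‖g₀‖`, replacing `g₀` by `f` costs at most `ε² / 4`. With the `ε² / 8`
  -- below, the expansion of `‖g n - g₀‖²` is at most `3 ε² / 4`.
  obtain ⟨f, hf, hgf⟩ := hS.exists_dist_lt g₀ (show 0 < ε ^ 2 / (8 * (‖g₀‖ + 1)) by positivity)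
  obtain ⟨N, hN⟩ := Metric.tendsto_atTop.1 (h f hf) (ε ^ 2 / 8) (by positivity)
  refine ⟨N, fun n hn => ?_⟩
  have h1 := hN n hn
  rw [Real.dist_eq] at h1
  rw [dist_eq_norm] at hgf ⊢
  have h2 := norm_sub_sq_real (g n) g₀
  have h3 : inner ℝ (g n) g₀ = inner ℝ (g n) f - inner ℝ g₀ f + ‖g₀‖ ^ 2
      + inner ℝ (g n - g₀) (g₀ - f) := by
    rw [← real_inner_self_eq_norm_sq, inner_sub_left, inner_sub_right, inner_sub_right]; ring
  have h4 := abs_real_inner_le_norm (g n - g₀) (g₀ - f)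
  have h5 : ‖g n - g₀‖ ≤ 2 * ‖g₀‖ := (norm_sub_le _ _).trans (by linarith [hg n])
  have h6 : ‖g n - g₀‖ * ‖g₀ - f‖ ≤ ε ^ 2 / 4 := by
    calc ‖g n - g₀‖ * ‖g₀ - f‖ ≤ (2 * (‖g₀‖ + 1)) * (ε ^ 2 / (8 * (‖g₀‖ + 1))) := by
          gcongr; linarith
      _ = ε ^ 2 / 4 := by field_simp; ring
  have h7 : ‖g n - g₀‖ ^ 2 < ε ^ 2 := by
    have := abs_lt.1 h1
    have := abs_le.1 h4
    have := hg n
    have : ‖g n‖ ^ 2 ≤ ‖g₀‖ ^ 2 := by gcongr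
    nlinarith [sq_nonneg ε]
  exact lt_of_pow_lt_pow_left₀ 2 hε.le h7

end Hilbert

/-! ### Closedness of distributional derivatives -/

section Limits

variable {E : Type*} [NormedAddCommGroup E] [NormedSpace ℝ E] [FiniteDimensional ℝ E]
  [MeasurableSpace E] [BorelSpace E] {μ : Measure E} [IsFiniteMeasureOnCompacts μ]

theorem tendsto_integral_mul_fderiv {D : Set E} {u : ℕ → E → ℝ} {u₀ : E → ℝ}
    (hu : ∀ n, ∀ K ⊆ D, IsCompact K → MemLp (u n) 2 (μ.restrict K))
    (hu₀ : ∀ K ⊆ D, IsCompact K → MemLp u₀ 2 (μ.restrict K))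
    (hconv : ∀ K ⊆ D, IsCompact K →
      Tendsto (fun n => eLpNorm (u n - u₀) 2 (μ.restrict K)) atTop (𝓝 0))
    {φ : E → ℝ} (hφ : φ ∈ testFunctions D) (h : E) :
    Tendsto (fun n => ∫ x in D, u n x * fderiv ℝ φ x h ∂μ) atTop
      (𝓝 (∫ x in D, u₀ x * fderiv ℝ φ x h ∂μ)) := by
  set ψ : E → ℝ := fun x => fderiv ℝ φ x h with hψ
  have hψc : Continuous ψ := continuous_fderiv_apply hφ.1 h
  have hψs : HasCompactSupport ψ := hasCompactSupport_fderiv_apply hφ.2.1 h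
  have hψD : tsupport ψ ⊆ D := (tsupport_fderiv_apply_subset ℝ h).trans hφ.2.2
  have hm : MemLp ψ 2 (μ.restrict (tsupport ψ)) :=
    (hψc.memLp_of_hasCompactSupport hψs).restrict _
  rw [tendsto_iff_norm_sub_tendsto_zero]
  have hlim : Tendsto (fun n => (eLpNorm (u n - u₀) 2 (μ.restrict (tsupport ψ))).toReal *
      (eLpNorm ψ 2 (μ.restrict (tsupport ψ))).toReal) atTop (𝓝 0) := by
    have := ((ENNReal.tendsto_toReal ENNReal.zero_ne_top).comp (hconv _ hψD hψs)).mul_const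
      (eLpNorm ψ 2 (μ.restrict (tsupport ψ))).toReal
    simpa using this
  refine squeeze_zero (fun _ => norm_nonneg _) (fun n => ?_) hlim
  rw [setIntegral_eq_of_support_subset hψD, setIntegral_eq_of_support_subset hψD,
    ← integral_sub (integrable_mul_of_tsupport_subset (hu n) hψc hψs hψD)
      (integrable_mul_of_tsupport_subset hu₀ hψc hψs hψD)]
  have e : ∫ x, (u n x * ψ x - u₀ x * ψ x) ∂μ = ∫ x in tsupport ψ, (u n - u₀) x * ψ x ∂μ := by
    rw [setIntegral_eq_of_support_subset subset_rfl]
    exact integral_congr_ae (ae_of_all _ fun x => by simp [sub_mul])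
  rw [e, Real.norm_eq_abs]
  exact abs_integral_mul_le ((hu n _ hψD hψs).sub (hu₀ _ hψD hψs)) hm

/-- Test functions have compact support, so `L²_loc` convergence of the functions is enough. This
covers both sequences in `L²(D)` and approximating sequences whose limit need not be in `L²(D)`. -/
theorem HasWeakDeriv.of_tendsto {D : Set E} {h : E} {u : ℕ → E → ℝ} {u₀ : E → ℝ}
    {g : ℕ → Lp ℝ 2 (μ.restrict D)} {g₀ : Lp ℝ 2 (μ.restrict D)}
    (hu : ∀ n, ∀ K ⊆ D, IsCompact K → MemLp (u n) 2 (μ.restrict K))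
    (hu₀ : ∀ K ⊆ D, IsCompact K → MemLp u₀ 2 (μ.restrict K))
    (hconv : ∀ K ⊆ D, IsCompact K →
      Tendsto (fun n => eLpNorm (u n - u₀) 2 (μ.restrict K)) atTop (𝓝 0))
    (hg : Tendsto g atTop (𝓝 g₀)) (hw : ∀ n, HasWeakDeriv μ D h (u n) (g n)) :
    HasWeakDeriv μ D h u₀ g₀ := by
  intro φ hφ
  refine tendsto_nhds_unique (tendsto_integral_mul_fderiv hu hu₀ hconv hφ h) ?_
  simp_rw [fun n => hw n φ hφ, ← inner_testToLp _ (⟨φ, hφ⟩ : testFunctions D)]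
  exact (hg.inner tendsto_const_nhds).neg

end Limits

/-! ### Poincaré inequality and functions with zero gradient -/

section Poincare

variable {d : ℕ}

theorem hasWeakPartial_iff {D : Set (EuclideanSpace ℝ (Fin d))} {i : Fin d}
    {u g : EuclideanSpace ℝ (Fin d) → ℝ} :
    HasWeakPartial D i u g ↔ HasWeakDeriv volume D (EuclideanSpace.single i 1) u g :=
  ⟨fun h φ hφ => h φ hφ.1 hφ.2.1 hφ.2.2, fun h φ h1 h2 h3 => h φ ⟨h1, h2, h3⟩⟩

/-- Translations occur in every direction, so the coordinate derivatives are assembled linearly. -/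
theorem HasWeakPartial.hasWeakDeriv {D : Set (EuclideanSpace ℝ (Fin d))}
    {u : EuclideanSpace ℝ (Fin d) → ℝ} {g : Fin d → Lp ℝ 2 (volume.restrict D)}
    (hu : ∀ K ⊆ D, IsCompact K → MemLp u 2 (volume.restrict K))
    (hw : ∀ i, HasWeakPartial D i u (g i)) (h : EuclideanSpace ℝ (Fin d)) :
    HasWeakDeriv volume D h u (∑ i, h i • g i : Lp ℝ 2 (volume.restrict D)) := by
  intro φ hφ
  have hi : ∀ i : Fin d, Integrable (fun x => u x * fderiv ℝ φ x (EuclideanSpace.single i 1))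
      (volume.restrict D) := fun i =>
    (integrable_mul_of_tsupport_subset hu (continuous_fderiv_apply hφ.1 _)
      (hasCompactSupport_fderiv_apply hφ.2.1 _)
      ((tsupport_fderiv_apply_subset ℝ _).trans hφ.2.2)).restrict
  have hsum : h = ∑ i, h i • (EuclideanSpace.single i 1 : EuclideanSpace ℝ (Fin d)) := by
    have := (EuclideanSpace.basisFun (Fin d) ℝ).sum_repr h
    simpa using this.symm
  rw [← inner_testToLp _ (⟨φ, hφ⟩ : testFunctions D), sum_inner, ← Finset.sum_neg_distrib]
  have e : ∀ x, u x * fderiv ℝ φ x h =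
      ∑ i, h i * (u x * fderiv ℝ φ x (EuclideanSpace.single i 1)) := by
    intro x
    conv_lhs => rw [hsum]
    rw [map_sum, Finset.mul_sum]
    exact Finset.sum_congr rfl fun i _ => by rw [map_smul, smul_eq_mul]; ring
  simp_rw [e]
  rw [integral_finsetSum _ fun i _ => (hi i).const_mul _]
  refine Finset.sum_congr rfl fun i _ => ?_
  rw [integral_const_mul, real_inner_smul_left, inner_testToLp, hw i φ hφ.1 hφ.2.1 hφ.2.2]
  ring

/-- A Poincaré inequality on balls, in terms of double integrals. -/
theorem lintegral_lintegral_enorm_sub_sq_le {D : Set (EuclideanSpace ℝ (Fin d))}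
    {a : EuclideanSpace ℝ (Fin d)} {r : ℝ} (hball : Metric.closedBall a (3 * r) ⊆ D)
    {u : EuclideanSpace ℝ (Fin d) → ℝ} (hum : Measurable u)
    (hu : ∀ K ⊆ D, IsCompact K → MemLp u 2 (volume.restrict K))
    {g : Fin d → Lp ℝ 2 (volume.restrict D)} (hw : ∀ i, HasWeakPartial D i u (g i)) :
    ∫⁻ x in Metric.ball a r, ∫⁻ y in Metric.ball a r, ‖u x - u y‖ₑ ^ 2 ≤
      ENNReal.ofReal (2 * r * ∑ i, ‖g i‖) ^ 2 *
        volume (Metric.ball (0 : EuclideanSpace ℝ (Fin d)) (2 * r)) := by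
  set B := Metric.ball a r with hB
  set B2 := Metric.ball (0 : EuclideanSpace ℝ (Fin d)) (2 * r) with hB2
  calc ∫⁻ x in B, ∫⁻ y in B, ‖u x - u y‖ₑ ^ 2
      ≤ ∫⁻ x in B, ∫⁻ h in B2, ‖u (x + h) - u x‖ₑ ^ 2 := by
        -- Substitute `y = x + h`: two points of a ball of radius `r` differ by a vector of norm
        -- less than `2 r`.
        refine setLIntegral_mono' measurableSet_ball fun x hx => ?_
        rw [← lintegral_indicator measurableSet_ball, ← lintegral_indicator measurableSet_ball,
          ← lintegral_add_left_eq_self _ x]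
        refine lintegral_mono fun h => ?_
        by_cases hxh : x + h ∈ B
        · have hh : h ∈ B2 := by
            rw [hB2, mem_ball_zero_iff]
            rw [hB, Metric.mem_ball] at hx hxh
            have := dist_triangle_right (x + h) x a
            rw [dist_eq_norm, add_sub_cancel_left] at this
            linarith
          rw [← hB, ← hB2, indicator_of_mem hxh, indicator_of_mem hh, ← enorm_neg, neg_sub]
        · rw [← hB, indicator_of_notMem hxh]
          exact zero_le
    _ = ∫⁻ h in B2, ∫⁻ x in B, ‖u (x + h) - u x‖ₑ ^ 2 := by
        refine lintegral_lintegral_swap (Measurable.aemeasurable ?_)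
        exact (((hum.comp (measurable_fst.add measurable_snd)).sub
          (hum.comp measurable_fst)).enorm).pow_const 2
    _ ≤ ∫⁻ h in B2, ENNReal.ofReal (2 * r * ∑ i, ‖g i‖) ^ 2 := by
        refine setLIntegral_mono' measurableSet_ball fun h hh => ?_
        rw [hB2, mem_ball_zero_iff] at hh
        set G : Lp ℝ 2 (volume.restrict D) := ∑ i, h i • g i
        -- Radius `3 r` is what is needed to contain every `x + t h` with `x` in the ball of radius
        -- `r` and `‖h‖ < 2 r`.
        have h1 := eLpNorm_translate_sub_le (isCompact_closedBall a (3 * r)) hball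
          (Metric.isOpen_ball (x := a) (ε := r)) (h := h) (fun x hx t ht => ?_)
          (hu _ hball (isCompact_closedBall a (3 * r))) (Lp.memLp G)
          (HasWeakPartial.hasWeakDeriv hu hw h)
        · have h2 : ∫⁻ x in B, ‖u (x + h) - u x‖ₑ ^ 2 =
              eLpNorm (fun x => u (x + h) - u x) 2 (volume.restrict B) ^ 2 := by
            have := eLpNorm_nnreal_pow_eq_lintegral (μ := volume.restrict B)
              (f := fun x => u (x + h) - u x) (p := 2) (by simp)
            simpa using this.symm
          rw [h2]
          gcongr
          refine h1.trans ?_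
          have h3 : eLpNorm G 2 (volume.restrict D) = ENNReal.ofReal ‖G‖ := by
            rw [Lp.norm_def, ENNReal.ofReal_toReal (Lp.eLpNorm_ne_top G)]
          rw [h3]
          refine ENNReal.ofReal_le_ofReal ?_
          calc ‖G‖ ≤ ∑ i, ‖h i • g i‖ := norm_sum_le _ _
            _ ≤ ∑ i, 2 * r * ‖g i‖ := by
              refine Finset.sum_le_sum fun i _ => ?_
              rw [norm_smul]
              gcongr
              exact (PiLp.norm_apply_le h i).trans hh.le
            _ = 2 * r * ∑ i, ‖g i‖ := by rw [Finset.mul_sum]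
        · rw [Metric.mem_closedBall]
          rw [Metric.mem_ball] at hx
          have h4 : dist (x + t • h) x ≤ ‖h‖ := by
            rw [dist_eq_norm, add_sub_cancel_left, norm_smul, Real.norm_of_nonneg ht.1]
            exact mul_le_of_le_one_left (norm_nonneg _) ht.2
          linarith [dist_triangle (x + t • h) x a]
    _ = _ := by rw [setLIntegral_const]

/-- A function with vanishing distributional gradient on a connected open set is constant. -/
theorem exists_ae_eq_const {D : Set (EuclideanSpace ℝ (Fin d))} (hD : IsOpen D)
    (hconn : IsConnected D) {u : EuclideanSpace ℝ (Fin d) → ℝ} (hum : Measurable u)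
    (hu : ∀ K ⊆ D, IsCompact K → MemLp u 2 (volume.restrict K))
    (hw : ∀ i, HasWeakPartial D i u (0 : Lp ℝ 2 (volume.restrict D))) :
    ∃ c : ℝ, ∀ᵐ x ∂(volume.restrict D), u x = c := by
  have hloc : ∀ a ∈ D, ∃ r > 0, ∃ c : ℝ, Metric.ball a r ⊆ D ∧
      ∀ᵐ x ∂(volume.restrict (Metric.ball a r)), u x = c := by
    intro a ha
    obtain ⟨ε, hε, hεD⟩ := Metric.isOpen_iff.1 hD a ha
    have hr : 0 < ε / 4 := by positivity
    have hsub : Metric.closedBall a (3 * (ε / 4)) ⊆ D :=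
      (Metric.closedBall_subset_ball (by linarith)).trans hεD
    have hP := lintegral_lintegral_enorm_sub_sq_le hsub hum hu hw
    simp only [norm_zero, Finset.sum_const_zero, mul_zero, ENNReal.ofReal_zero, ne_eq,
      OfNat.ofNat_ne_zero, not_false_eq_true, zero_pow, zero_mul, nonpos_iff_eq_zero] at hP
    have hmeas : Measurable fun p : EuclideanSpace ℝ (Fin d) × EuclideanSpace ℝ (Fin d) =>
        ‖u p.1 - u p.2‖ₑ ^ 2 :=
      (((hum.comp measurable_fst).sub (hum.comp measurable_snd)).enorm).pow_const 2
    rw [lintegral_eq_zero_iff hmeas.lintegral_prod_right'] at hP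
    have hpos : volume.restrict (Metric.ball a (ε / 4)) ≠ 0 := by
      rw [Ne, Measure.restrict_eq_zero]
      exact (Metric.measure_ball_pos volume a hr).ne'
    have : NeBot (ae (volume.restrict (Metric.ball a (ε / 4)))) := ae_neBot.2 hpos
    -- The double integral vanishes, so for some `x` the function equals `u x` almost everywhere on
    -- the ball.
    obtain ⟨x, hx⟩ := hP.exists
    replace hx : ∫⁻ y in Metric.ball a (ε / 4), ‖u x - u y‖ₑ ^ 2 = 0 := hx
    rw [lintegral_eq_zero_iff (by fun_prop)] at hx
    refine ⟨ε / 4, hr, u x, (Metric.ball_subset_ball (by linarith)).trans hεD, ?_⟩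
    filter_upwards [hx] with y hy
    have : u x - u y = 0 := by simpa using hy
    linarith
  choose! r hr c hrD hc using hloc
  have hconst : ∀ x ∈ D, ∀ y ∈ D, c x = c y := by
    -- If the centre of one ball lies in another, the two overlap in positive measure, which forces
    -- equal constants. The constant is thus locally constant in the centre.
    have hlc : ∀ x ∈ D, ∀ y ∈ D, y ∈ Metric.ball x (r x) → c y = c x := by
      intro x hx y hy hyx
      have hpos : volume (Metric.ball x (r x) ∩ Metric.ball y (r y)) ≠ 0 :=
        ((Metric.isOpen_ball.inter Metric.isOpen_ball).measure_pos volume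
          ⟨y, hyx, Metric.mem_ball_self (hr y hy)⟩).ne'
      have : NeBot (ae (volume.restrict (Metric.ball x (r x) ∩ Metric.ball y (r y)))) := by
        rw [ae_neBot, Ne, Measure.restrict_eq_zero]; exact hpos
      obtain ⟨z, hz1, hz2⟩ := ((ae_restrict_of_ae_restrict_of_subset inter_subset_left
        (hc x hx)).and (ae_restrict_of_ae_restrict_of_subset inter_subset_right (hc y hy))).exists
      rw [← hz1, ← hz2]
    have : PreconnectedSpace D := isPreconnected_iff_preconnectedSpace.1 hconn.isPreconnected
    have hL : IsLocallyConstant fun x : D => c x := by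
      rw [IsLocallyConstant.iff_eventually_eq]
      intro x
      have : Subtype.val ⁻¹' Metric.ball (x : EuclideanSpace ℝ (Fin d)) (r x) ∈ 𝓝 x :=
        continuous_subtype_val.continuousAt.preimage_mem_nhds
          (Metric.ball_mem_nhds _ (hr x x.2))
      filter_upwards [this] with y hy
      exact hlc x x.2 y y.2 hy
    intro x hx y hy
    exact hL.apply_eq_of_preconnectedSpace ⟨x, hx⟩ ⟨y, hy⟩
  obtain ⟨x₀, hx₀⟩ := hconn.nonempty
  refine ⟨c x₀, ?_⟩
  obtain ⟨t, htD, htc, hcover⟩ := TopologicalSpace.countable_cover_nhdsWithin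
    (f := fun x => Metric.ball x (r x)) (s := D)
    fun x hx => mem_nhdsWithin_of_mem_nhds (Metric.ball_mem_nhds x (hr x hx))
  refine ae_restrict_of_ae_restrict_of_subset hcover ?_
  rw [ae_restrict_biUnion_iff _ htc]
  intro x hx
  filter_upwards [hc x (htD hx)] with y hy
  rw [hy, hconst x (htD hx) x₀ hx₀]

end Poincare

/-! ### The gradient and the Dirichlet form on `W^{1,2}(D)` -/

section Gradient

variable {d : ℕ} {D : Set (EuclideanSpace ℝ (Fin d))}

theorem HasWeakPartial.congr {i : Fin d} {u u' g g' : EuclideanSpace ℝ (Fin d) → ℝ}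
    (h : HasWeakPartial D i u g) (hu : u =ᵐ[volume.restrict D] u')
    (hg : g =ᵐ[volume.restrict D] g') : HasWeakPartial D i u' g' := by
  intro φ h1 h2 h3
  have e1 : ∫ x in D, u' x * fderiv ℝ φ x (EuclideanSpace.single i 1) =
      ∫ x in D, u x * fderiv ℝ φ x (EuclideanSpace.single i 1) :=
    integral_congr_ae (by filter_upwards [hu] with x hx; rw [hx])
  have e2 : ∫ x in D, g' x * φ x = ∫ x in D, g x * φ x :=
    integral_congr_ae (by filter_upwards [hg] with x hx; rw [hx])
  rw [e1, e2, h φ h1 h2 h3]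

/-- Test functions separate `L²(D)`, so the choice in the definition is harmless. -/
theorem weakPartial_eq (hD : IsOpen D) {i : Fin d}
    {u : EuclideanSpace ℝ (Fin d) →ₘ[volume.restrict D] ℝ} {g : Lp ℝ 2 (volume.restrict D)}
    (h : HasWeakPartial D i u g) : weakPartial D i u = g := by
  have hex : ∃ g : Lp ℝ 2 (volume.restrict D), HasWeakPartial D i u g := ⟨g, h⟩
  rw [weakPartial, dif_pos hex]
  refine eq_of_integral_mul_eq hD fun φ hφ => ?_
  have h1 := hex.choose_spec φ hφ.1 hφ.2.1 hφ.2.2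
  have h2 := h φ hφ.1 hφ.2.1 hφ.2.2
  rw [h1] at h2
  exact neg_injective h2

theorem hasWeakPartial_weakPartial {u : EuclideanSpace ℝ (Fin d) →ₘ[volume.restrict D] ℝ}
    (hu : u ∈ BL D) (i : Fin d) : HasWeakPartial D i u (weakPartial D i u) := by
  rw [weakPartial, dif_pos (hu.2 i)]
  exact (hu.2 i).choose_spec

/-- The distributional gradient, with values in `L²(D)^d`. -/
def grad (D : Set (EuclideanSpace ℝ (Fin d)))
    (u : EuclideanSpace ℝ (Fin d) →ₘ[volume.restrict D] ℝ) :
    PiLp 2 fun _ : Fin d => Lp ℝ 2 (volume.restrict D) :=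
  WithLp.toLp 2 fun i => weakPartial D i u

theorem dirichletIntegral_eq_inner (u v : EuclideanSpace ℝ (Fin d) →ₘ[volume.restrict D] ℝ) :
    dirichletIntegral D u v = inner ℝ (grad D u) (grad D v) := by
  rw [PiLp.inner_apply]
  exact Finset.sum_congr rfl fun i _ => (inner_Lp_eq_integral _ _).symm

theorem halfD_self (u : Lp ℝ 2 (volume.restrict D)) :
    halfD D u u = 1 / 2 * ‖grad D u‖ ^ 2 := by
  rw [halfD, dirichletIntegral_eq_inner, real_inner_self_eq_norm_sq]

theorem grad_eq (hD : IsOpen D) {u : EuclideanSpace ℝ (Fin d) →ₘ[volume.restrict D] ℝ}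
    {G : PiLp 2 fun _ : Fin d => Lp ℝ 2 (volume.restrict D)}
    (h : ∀ i, HasWeakPartial D i u (G i)) : grad D u = G := by
  ext1 i
  exact weakPartial_eq hD (h i)

theorem memLp_restrict_compact (u : Lp ℝ 2 (volume.restrict D)) :
    ∀ K ⊆ D, IsCompact K → MemLp u 2 (volume.restrict K) := fun _ hKD _ =>
  (Lp.memLp u).mono_measure (Measure.restrict_mono_set _ hKD)

theorem mem_W12_iff {u : Lp ℝ 2 (volume.restrict D)} :
    u ∈ W12 D ↔ ∀ i, ∃ g : Lp ℝ 2 (volume.restrict D), HasWeakPartial D i u g :=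
  ⟨fun h => h.2, fun h => ⟨memLp_restrict_compact u, h⟩⟩

theorem integrable_mul_fderiv {u : EuclideanSpace ℝ (Fin d) → ℝ}
    (hu : ∀ K ⊆ D, IsCompact K → MemLp u 2 (volume.restrict K))
    {φ : EuclideanSpace ℝ (Fin d) → ℝ} (hφ : φ ∈ testFunctions D) (h : EuclideanSpace ℝ (Fin d)) :
    Integrable (fun x => u x * fderiv ℝ φ x h) (volume.restrict D) :=
  (integrable_mul_of_tsupport_subset hu (continuous_fderiv_apply hφ.1 _)
    (hasCompactSupport_fderiv_apply hφ.2.1 _)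
    ((tsupport_fderiv_apply_subset ℝ _).trans hφ.2.2)).restrict

theorem hasWeakPartial_add {i : Fin d} {u v : EuclideanSpace ℝ (Fin d) → ℝ}
    {f g : Lp ℝ 2 (volume.restrict D)}
    (hu : ∀ K ⊆ D, IsCompact K → MemLp u 2 (volume.restrict K))
    (hv : ∀ K ⊆ D, IsCompact K → MemLp v 2 (volume.restrict K))
    (hf : HasWeakPartial D i u f) (hg : HasWeakPartial D i v g) :
    HasWeakPartial D i (u + v) (f + g : Lp ℝ 2 (volume.restrict D)) := by
  intro φ h1 h2 h3
  have hφ : φ ∈ testFunctions D := ⟨h1, h2, h3⟩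
  rw [← inner_testToLp _ (⟨φ, hφ⟩ : testFunctions D), inner_add_left, inner_testToLp,
    inner_testToLp, neg_add, ← hf φ h1 h2 h3, ← hg φ h1 h2 h3,
    ← integral_add (integrable_mul_fderiv hu hφ _) (integrable_mul_fderiv hv hφ _)]
  exact integral_congr_ae (ae_of_all _ fun x => by simp [add_mul])

theorem hasWeakPartial_const_smul {i : Fin d} {u : EuclideanSpace ℝ (Fin d) → ℝ}
    {f : Lp ℝ 2 (volume.restrict D)} (hf : HasWeakPartial D i u f) (c : ℝ) :
    HasWeakPartial D i (c • u) (c • f : Lp ℝ 2 (volume.restrict D)) := by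
  intro φ h1 h2 h3
  have hφ : φ ∈ testFunctions D := ⟨h1, h2, h3⟩
  rw [← inner_testToLp _ (⟨φ, hφ⟩ : testFunctions D), real_inner_smul_left, inner_testToLp,
    ← mul_neg, ← hf φ h1 h2 h3, ← integral_const_mul]
  exact integral_congr_ae (ae_of_all _ fun x => by simp [mul_assoc])

theorem hasWeakPartial_add_Lp {i : Fin d} {u v f g : Lp ℝ 2 (volume.restrict D)}
    (hf : HasWeakPartial D i u f) (hg : HasWeakPartial D i v g) :
    HasWeakPartial D i (u + v : Lp ℝ 2 (volume.restrict D))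
      (f + g : Lp ℝ 2 (volume.restrict D)) :=
  (hasWeakPartial_add (memLp_restrict_compact u) (memLp_restrict_compact v) hf hg).congr
    (Lp.coeFn_add u v).symm EventuallyEq.rfl

theorem hasWeakPartial_smul_Lp {i : Fin d} {u f : Lp ℝ 2 (volume.restrict D)}
    (hf : HasWeakPartial D i u f) (c : ℝ) :
    HasWeakPartial D i (c • u : Lp ℝ 2 (volume.restrict D))
      (c • f : Lp ℝ 2 (volume.restrict D)) :=
  (hasWeakPartial_const_smul hf c).congr (Lp.coeFn_smul c u).symm EventuallyEq.rfl

/-- The classical derivative of a smooth function is its distributional derivative. -/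
theorem hasWeakPartial_of_contDiff {ψ : EuclideanSpace ℝ (Fin d) → ℝ} (hψ : ContDiff ℝ ∞ ψ)
    (i : Fin d) :
    HasWeakPartial D i ψ fun x => fderiv ℝ ψ x (EuclideanSpace.single i 1) := by
  intro φ h1 h2 h3
  set e : EuclideanSpace ℝ (Fin d) := EuclideanSpace.single i 1
  have e1 : tsupport (fun x => fderiv ℝ φ x e) ⊆ D :=
    (tsupport_fderiv_apply_subset ℝ _).trans h3
  rw [setIntegral_eq_of_support_subset h3, setIntegral_eq_of_support_subset e1]
  refine integral_mul_fderiv_eq_neg_fderiv_mul_of_integrable ?_ ?_ ?_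
    (fun x _ => hψ.differentiable (by simp) x) (fun x _ => h1.differentiable (by simp) x)
  · exact ((continuous_fderiv_apply hψ e).mul h1.continuous).integrable_of_hasCompactSupport
      h2.mul_left
  · exact (hψ.continuous.mul (continuous_fderiv_apply h1 e)).integrable_of_hasCompactSupport
      (hasCompactSupport_fderiv_apply h2 e).mul_left
  · exact (hψ.continuous.mul h1.continuous).integrable_of_hasCompactSupport h2.mul_left

theorem zero_mem_W12 : (0 : Lp ℝ 2 (volume.restrict D)) ∈ W12 D := by
  refine mem_W12_iff.2 fun i => ⟨0, ?_⟩
  intro φ _ _ _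
  have e1 : ∫ x in D, (0 : Lp ℝ 2 (volume.restrict D)) x *
      fderiv ℝ φ x (EuclideanSpace.single i 1) = 0 :=
    integral_eq_zero_of_ae (by
      filter_upwards [Lp.coeFn_zero ℝ 2 (volume.restrict D)] with x hx; rw [hx]; simp)
  have e2 : ∫ x in D, (0 : Lp ℝ 2 (volume.restrict D)) x * φ x = 0 :=
    integral_eq_zero_of_ae (by
      filter_upwards [Lp.coeFn_zero ℝ 2 (volume.restrict D)] with x hx; rw [hx]; simp)
  rw [e1, e2, neg_zero]

theorem hasWeakPartial_grad {u : Lp ℝ 2 (volume.restrict D)} (hu : u ∈ W12 D) (i : Fin d) :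
    HasWeakPartial D i u (grad D u i) :=
  hasWeakPartial_weakPartial hu i

theorem add_mem_W12 {u v : Lp ℝ 2 (volume.restrict D)} (hu : u ∈ W12 D) (hv : v ∈ W12 D) :
    u + v ∈ W12 D :=
  mem_W12_iff.2 fun i => ⟨_, hasWeakPartial_add_Lp (hasWeakPartial_grad hu i)
    (hasWeakPartial_grad hv i)⟩

theorem smul_mem_W12 (c : ℝ) {u : Lp ℝ 2 (volume.restrict D)} (hu : u ∈ W12 D) : c • u ∈ W12 D :=
  mem_W12_iff.2 fun i => ⟨_, hasWeakPartial_smul_Lp (hasWeakPartial_grad hu i) c⟩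

theorem grad_add (hD : IsOpen D) {u v : Lp ℝ 2 (volume.restrict D)} (hu : u ∈ W12 D)
    (hv : v ∈ W12 D) :
    grad D (u + v : Lp ℝ 2 (volume.restrict D)) = grad D u + grad D v :=
  grad_eq hD fun i => hasWeakPartial_add_Lp (hasWeakPartial_grad hu i) (hasWeakPartial_grad hv i)

theorem grad_smul (hD : IsOpen D) (c : ℝ) {u : Lp ℝ 2 (volume.restrict D)} (hu : u ∈ W12 D) :
    grad D (c • u : Lp ℝ 2 (volume.restrict D)) = c • grad D u :=
  grad_eq hD fun i => hasWeakPartial_smul_Lp (hasWeakPartial_grad hu i) c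

theorem sub_mem_W12 {u v : Lp ℝ 2 (volume.restrict D)} (hu : u ∈ W12 D) (hv : v ∈ W12 D) :
    u - v ∈ W12 D := by
  have := add_mem_W12 hu (smul_mem_W12 (-1) hv)
  rwa [neg_one_smul, ← sub_eq_add_neg] at this

theorem grad_sub (hD : IsOpen D) {u v : Lp ℝ 2 (volume.restrict D)} (hu : u ∈ W12 D)
    (hv : v ∈ W12 D) :
    grad D (u - v : Lp ℝ 2 (volume.restrict D)) = grad D u - grad D v := by
  have := grad_add hD hu (smul_mem_W12 (-1) hv)
  rwa [grad_smul hD _ hv, neg_one_smul, neg_one_smul, ← sub_eq_add_neg, ← sub_eq_add_neg] at this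

/-- The gradient is a closed operator on `L²(D)`. -/
theorem mem_W12_of_tendsto (hD : IsOpen D) {u : ℕ → Lp ℝ 2 (volume.restrict D)}
    {u₀ : Lp ℝ 2 (volume.restrict D)} {G : PiLp 2 fun _ : Fin d => Lp ℝ 2 (volume.restrict D)}
    (hu : ∀ n, u n ∈ W12 D) (hlim : Tendsto u atTop (𝓝 u₀))
    (hG : Tendsto (fun n => grad D (u n)) atTop (𝓝 G)) : u₀ ∈ W12 D ∧ grad D u₀ = G := by
  have hw : ∀ i, HasWeakPartial D i u₀ (G i) := by
    intro i
    rw [hasWeakPartial_iff]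
    refine HasWeakDeriv.of_tendsto (fun n => memLp_restrict_compact (u n))
      (memLp_restrict_compact u₀) (fun K hKD _ => ?_) (g := fun n => grad D (u n) i) ?_
      fun n => hasWeakPartial_iff.1 (hasWeakPartial_grad (hu n) i)
    · have h1 := (Lp.tendsto_Lp_iff_tendsto_eLpNorm' u u₀).1 hlim
      exact tendsto_of_tendsto_of_tendsto_of_le_of_le tendsto_const_nhds h1 (fun _ => zero_le)
        fun n => eLpNorm_mono_measure _ (Measure.restrict_mono_set _ hKD)
    · exact ((PiLp.continuous_apply 2 (fun _ : Fin d => Lp ℝ 2 (volume.restrict D)) i).tendsto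
        G).comp hG
  exact ⟨mem_W12_iff.2 fun i => ⟨_, hw i⟩, grad_eq hD hw⟩

/-- Normal contractions operate on `BL(D)`. -/
theorem mem_BL_of_comp_lipschitz (hD : IsOpen D)
    {u v : EuclideanSpace ℝ (Fin d) →ₘ[volume.restrict D] ℝ} (hu : u ∈ BL D) {N : ℝ → ℝ}
    (hN : LipschitzWith 1 N) (hN0 : N 0 = 0) (hv : v =ᵐ[volume.restrict D] N ∘ u) :
    v ∈ BL D ∧ ∀ i, ‖weakPartial D i v‖ ≤ ‖weakPartial D i u‖ := by
  have key : ∀ i, ∃ g : Lp ℝ 2 (volume.restrict D), ‖g‖ ≤ ‖weakPartial D i u‖ ∧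
      HasWeakPartial D i v g := by
    intro i
    obtain ⟨g, hg, hw⟩ := (hasWeakPartial_iff.1 (hasWeakPartial_weakPartial hu i)).comp_lipschitz
      hD hu.1 hN hN0
    exact ⟨g, hg, (hasWeakPartial_iff.2 hw).congr hv.symm EventuallyEq.rfl⟩
  refine ⟨⟨fun K hKD hK => ?_, fun i => ?_⟩, fun i => ?_⟩
  · have hvK : v =ᵐ[volume.restrict K] N ∘ u := ae_restrict_of_ae_restrict_of_subset hKD hv
    exact (hN.comp_memLp hN0 (hu.1 K hKD hK)).ae_eq hvK.symm
  · obtain ⟨g, -, hg⟩ := key i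
    exact ⟨g, hg⟩
  · obtain ⟨g, hg, hw⟩ := key i
    rwa [weakPartial_eq hD hw]

theorem norm_grad_le {u v : EuclideanSpace ℝ (Fin d) →ₘ[volume.restrict D] ℝ}
    (h : ∀ i, ‖weakPartial D i v‖ ≤ ‖weakPartial D i u‖) : ‖grad D v‖ ≤ ‖grad D u‖ := by
  rw [← sq_le_sq₀ (norm_nonneg _) (norm_nonneg _), PiLp.norm_sq_eq_of_L2, PiLp.norm_sq_eq_of_L2]
  exact Finset.sum_le_sum fun i _ => pow_le_pow_left₀ (norm_nonneg _) (h i) 2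

/-- Finite volume puts constants into the domain; this is the source of both invariance and
conservation of mass. -/
theorem const_mem_W12 (hD : IsOpen D) [IsFiniteMeasure (volume.restrict D)] (c : ℝ) :
    Lp.const 2 (volume.restrict D) c ∈ W12 D ∧
      grad D (Lp.const 2 (volume.restrict D) c : Lp ℝ 2 (volume.restrict D)) = 0 := by
  have hw : ∀ i, HasWeakPartial D i (Lp.const 2 (volume.restrict D) c)
      (0 : Lp ℝ 2 (volume.restrict D)) := fun i =>
    (hasWeakPartial_of_contDiff (ψ := fun _ => c) contDiff_const i).congr
      (Lp.coeFn_const 2 (volume.restrict D) c).symm (by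
        filter_upwards [Lp.coeFn_zero ℝ 2 (volume.restrict D)] with x hx
        rw [hx]; simp)
  exact ⟨mem_W12_iff.2 fun i => ⟨_, hw i⟩, grad_eq hD hw⟩

theorem testToLp_mem_W12 (φ : testFunctions D) : testToLp volume D φ ∈ W12 D := by
  refine mem_W12_iff.2 fun i => ?_
  have hm : MemLp (fun x => fderiv ℝ (φ : EuclideanSpace ℝ (Fin d) → ℝ) x
      (EuclideanSpace.single i 1)) 2 (volume.restrict D) :=
    ((continuous_fderiv_apply φ.2.1 _).memLp_of_hasCompactSupport
      (hasCompactSupport_fderiv_apply φ.2.2.1 _)).restrict D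
  exact ⟨hm.toLp _, (hasWeakPartial_of_contDiff φ.2.1 i).congr
    (memLp_of_mem_testFunctions φ.2 D 2).coeFn_toLp.symm hm.coeFn_toLp.symm⟩

theorem dense_W12 (hD : IsOpen D) : Dense (W12 D) :=
  (denseRange_testToLp (μ := volume) hD).mono (by rintro _ ⟨φ, rfl⟩; exact testToLp_mem_W12 φ)

theorem lipschitzWith_clip (a b : ℝ) : LipschitzWith 1 fun x : ℝ => min (max x a) b :=
  (LipschitzWith.id.max_const a).min_const b

/-- `(½𝐃, W^{1,2}(D))` is a Dirichlet form. -/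
theorem isDirichletForm_halfD (hD : IsOpen D) : IsDirichletForm (W12 D) (halfD D) where
  zero_mem := zero_mem_W12
  add_mem _ hu _ hv := add_mem_W12 hu hv
  smul_mem c _ hu := smul_mem_W12 c hu
  dense := dense_W12 hD
  add_left u hu v hv w _ := by
    simp only [halfD, dirichletIntegral_eq_inner, grad_add hD hu hv, inner_add_left]; ring
  smul_left c u hu v _ := by
    simp only [halfD, dirichletIntegral_eq_inner, grad_smul hD c hu, real_inner_smul_left]; ring
  symm u _ v _ := by
    simp only [halfD, dirichletIntegral_eq_inner, real_inner_comm]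
  nonneg u _ := by rw [halfD_self]; positivity
  closed u hu := by
    obtain ⟨hF, hC⟩ := hu
    have hform : ∀ v w : Lp ℝ 2 (volume.restrict D), v ∈ W12 D → w ∈ W12 D →
        formOne (halfD D) (v - w) (v - w) = 1 / 2 * ‖grad D v - grad D w‖ ^ 2 + ‖v - w‖ ^ 2 := by
      intro v w hv hw
      rw [formOne, halfD_self, grad_sub hD hv hw, real_inner_self_eq_norm_sq]
    -- A Cauchy sequence for the form plus the `L²` product is Cauchy in `L²` together with its
    -- gradients, so closedness of the gradient identifies the limit.
    have hc1 : CauchySeq u := by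
      rw [Metric.cauchySeq_iff]
      intro ε hε
      obtain ⟨N, hN⟩ := hC (ε ^ 2) (by positivity)
      refine ⟨N, fun m hm n hn => ?_⟩
      have h1 := hN m hm n hn
      rw [hform _ _ (hF m) (hF n)] at h1
      rw [dist_eq_norm]
      refine lt_of_pow_lt_pow_left₀ 2 hε.le ?_
      nlinarith [sq_nonneg ‖grad D (u m) - grad D (u n)‖]
    have hc2 : CauchySeq fun n => grad D (u n) := by
      rw [Metric.cauchySeq_iff]
      intro ε hε
      obtain ⟨N, hN⟩ := hC (ε ^ 2 / 2) (by positivity)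
      refine ⟨N, fun m hm n hn => ?_⟩
      have h1 := hN m hm n hn
      rw [hform _ _ (hF m) (hF n)] at h1
      rw [dist_eq_norm]
      refine lt_of_pow_lt_pow_left₀ 2 hε.le ?_
      nlinarith [sq_nonneg ‖u m - u n‖]
    obtain ⟨v, hv⟩ := cauchySeq_tendsto_of_complete hc1
    obtain ⟨G, hG⟩ := cauchySeq_tendsto_of_complete hc2
    obtain ⟨hvW, hvG⟩ := mem_W12_of_tendsto hD hF hv hG
    refine ⟨v, hvW, ?_⟩
    simp_rw [fun n => hform _ _ (hF n) hvW, hvG]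
    have h1 := ((tendsto_iff_norm_sub_tendsto_zero.1 hG).pow 2).const_mul (1 / 2 : ℝ)
    have h2 := (tendsto_iff_norm_sub_tendsto_zero.1 hv).pow 2
    simpa using h1.add h2
  markov u hu := by
    have hN := lipschitzWith_clip 0 1
    have hN0 : min (max (0 : ℝ) 0) 1 = 0 := by simp
    have hcoe := hN.coeFn_compLp hN0 u
    obtain ⟨h1, h2⟩ := mem_BL_of_comp_lipschitz hD hu hN hN0 hcoe
    refine ⟨hN.compLp hN0 u, h1, hcoe, ?_⟩
    rw [halfD_self, halfD_self]
    have := norm_grad_le h2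
    gcongr

end Gradient

/-! ### The extended space equals `BL(D)` -/

section Extended

variable {d : ℕ} {D : Set (EuclideanSpace ℝ (Fin d))}

theorem cauchySeq_grad (hD : IsOpen D) {v : ℕ → Lp ℝ 2 (volume.restrict D)}
    (hv : IsFormCauchy (W12 D) (halfD D) v) : CauchySeq fun n => grad D (v n) := by
  obtain ⟨hF, hC⟩ := hv
  rw [Metric.cauchySeq_iff]
  intro ε hε
  obtain ⟨N, hN⟩ := hC (ε ^ 2 / 2) (by positivity)
  refine ⟨N, fun m hm n hn => ?_⟩
  have h1 := hN m hm n hn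
  rw [halfD_self, grad_sub hD (hF m) (hF n)] at h1
  rw [dist_eq_norm]
  exact lt_of_pow_lt_pow_left₀ 2 hε.le (by linarith)

theorem isFormCauchy_of_cauchySeq_grad (hD : IsOpen D) {v : ℕ → Lp ℝ 2 (volume.restrict D)}
    (hv : ∀ n, v n ∈ W12 D) (hc : CauchySeq fun n => grad D (v n)) :
    IsFormCauchy (W12 D) (halfD D) v := by
  refine ⟨hv, fun ε hε => ?_⟩
  obtain ⟨N, hN⟩ := Metric.cauchySeq_iff.1 hc (√ε) (Real.sqrt_pos.2 hε)
  refine ⟨N, fun m hm n hn => ?_⟩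
  have h1 := hN m hm n hn
  rw [dist_eq_norm] at h1
  rw [halfD_self, grad_sub hD (hv m) (hv n)]
  have h2 := pow_lt_pow_left₀ h1 (norm_nonneg _) two_ne_zero
  rw [Real.sq_sqrt hε.le] at h2
  linarith [sq_nonneg ‖grad D (v m) - grad D (v n)‖]

theorem enorm_sq_le_two_mul (a b : ℝ) : ‖a‖ₑ ^ 2 ≤ 2 * ‖a - b‖ₑ ^ 2 + 2 * ‖b‖ₑ ^ 2 := by
  simp only [Real.enorm_eq_ofReal_abs, ← ENNReal.ofReal_pow (abs_nonneg _), sq_abs]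
  rw [show (2 : ℝ≥0∞) = ENNReal.ofReal 2 by simp, ← ENNReal.ofReal_mul (by norm_num),
    ← ENNReal.ofReal_mul (by norm_num), ← ENNReal.ofReal_add (by positivity) (by positivity)]
  exact ENNReal.ofReal_le_ofReal (by nlinarith [sq_nonneg (a - 2 * b)])

/-- The `L²`-norm is controlled by the double integral of differences and the norm on a subset. -/
theorem measure_mul_lintegral_enorm_sq_le {α : Type*} [MeasurableSpace α] {μ : Measure α}
    {w : α → ℝ} (hw : Measurable w) (A : Set α) :
    μ A * ∫⁻ x, ‖w x‖ₑ ^ 2 ∂μ ≤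
      2 * ∫⁻ x, ∫⁻ y, ‖w x - w y‖ₑ ^ 2 ∂μ ∂μ + 2 * (μ univ * ∫⁻ y in A, ‖w y‖ₑ ^ 2 ∂μ) := by
  have hm1 : Measurable fun x => ‖w x‖ₑ ^ 2 := hw.enorm.pow_const 2
  calc μ A * ∫⁻ x, ‖w x‖ₑ ^ 2 ∂μ = ∫⁻ x, ∫⁻ _ in A, ‖w x‖ₑ ^ 2 ∂μ ∂μ := by
        simp_rw [setLIntegral_const]
        rw [lintegral_mul_const _ hm1, mul_comm]
    _ ≤ ∫⁻ x, (2 * ∫⁻ y, ‖w x - w y‖ₑ ^ 2 ∂μ + 2 * ∫⁻ y in A, ‖w y‖ₑ ^ 2 ∂μ) ∂μ := by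
        refine lintegral_mono fun x => ?_
        calc ∫⁻ _ in A, ‖w x‖ₑ ^ 2 ∂μ
            ≤ ∫⁻ y in A, (2 * ‖w x - w y‖ₑ ^ 2 + 2 * ‖w y‖ₑ ^ 2) ∂μ :=
              lintegral_mono fun y => enorm_sq_le_two_mul _ _
          _ = 2 * ∫⁻ y in A, ‖w x - w y‖ₑ ^ 2 ∂μ + 2 * ∫⁻ y in A, ‖w y‖ₑ ^ 2 ∂μ := by
              rw [lintegral_add_right _ (hm1.const_mul 2), lintegral_const_mul _ (by fun_prop),
                lintegral_const_mul _ hm1]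
          _ ≤ _ := by
              gcongr
              exact Measure.restrict_le_self
    _ = _ := by
        rw [lintegral_add_right _ measurable_const, lintegral_const_mul', lintegral_const]
        · ring
        · simp

/-- An approximating sequence converges in `L²` on small balls. -/
theorem IsApproximating.tendsto_lintegral_ball (hD : IsOpen D)
    {v : ℕ → Lp ℝ 2 (volume.restrict D)} {u : EuclideanSpace ℝ (Fin d) →ₘ[volume.restrict D] ℝ}
    (hv : IsApproximating (W12 D) (halfD D) v u) {a : EuclideanSpace ℝ (Fin d)} {r : ℝ} (hr : 0 < r)
    (hball : Metric.closedBall a (3 * r) ⊆ D) :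
    Tendsto (fun n => ∫⁻ x in Metric.ball a r, ‖v n x - u x‖ₑ ^ 2) atTop (𝓝 0) := by
  obtain ⟨hFC, hae⟩ := hv
  have hF := hFC.1
  set μ := volume.restrict (Metric.ball a r) with hμ
  have hBD : Metric.ball a r ⊆ D :=
    (Metric.ball_subset_closedBall.trans (Metric.closedBall_subset_closedBall (by linarith))).trans
      hball
  have : IsFiniteMeasure μ := ⟨by simpa [hμ] using measure_ball_lt_top⟩
  have hpos : 0 < μ univ := by simpa [hμ] using Metric.measure_ball_pos volume a hr
  have haeB : ∀ᵐ x ∂μ, Tendsto (fun n => v n x) atTop (𝓝 (u x)) :=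
    ae_restrict_of_ae_restrict_of_subset hBD hae
  -- Egorov with an exceptional set of at most half the mass of the ball; its complement has
  -- positive measure and can anchor the Poincaré inequality.
  obtain ⟨t, htm, htμ, hunif⟩ := tendstoUniformlyOn_of_ae_tendsto'
    (fun n => Lp.stronglyMeasurable (v n)) u.stronglyMeasurable haeB
    (ε := (μ univ).toReal / 2) (by have := ENNReal.toReal_pos hpos.ne' (measure_ne_top μ _); linarith)
  have hA0 : μ tᶜ ≠ 0 := by
    intro h0
    have h1 : μ univ ≤ μ t + μ tᶜ := by
      rw [← union_compl_self t]; exact measure_union_le _ _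
    rw [h0, add_zero] at h1
    have h2 := ENNReal.toReal_mono (by simp) (h1.trans htμ)
    have h3 := ENNReal.toReal_pos hpos.ne' (measure_ne_top μ _)
    rw [ENNReal.toReal_ofReal (by positivity)] at h2
    linarith
  have hgrad := cauchySeq_iff_tendsto_dist_atTop_0.1 (cauchySeq_grad hD hFC)
  have hlim1 : Tendsto (fun p : ℕ × ℕ => ∫⁻ x, ∫⁻ y,
      ‖(v p.1 - v p.2 : Lp ℝ 2 (volume.restrict D)) x -
        (v p.1 - v p.2 : Lp ℝ 2 (volume.restrict D)) y‖ₑ ^ 2 ∂μ ∂μ) atTop (𝓝 0) := by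
    have hs : Tendsto (fun p : ℕ × ℕ => ENNReal.ofReal (2 * r * ∑ i : Fin d,
        dist (grad D (v p.1)) (grad D (v p.2))) ^ 2 *
        volume (Metric.ball (0 : EuclideanSpace ℝ (Fin d)) (2 * r))) atTop (𝓝 0) := by
      have h1 : Tendsto (fun p : ℕ × ℕ => 2 * r * ∑ i : Fin d,
          dist (grad D (v p.1)) (grad D (v p.2))) atTop (𝓝 0) := by
        simpa using (tendsto_finsetSum Finset.univ fun (i : Fin d) _ => hgrad).const_mul (2 * r)
      have h2 := ENNReal.Tendsto.pow (n := 2) (ENNReal.tendsto_ofReal h1)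
      have h3 := ENNReal.Tendsto.mul_const h2 (b := volume (Metric.ball
        (0 : EuclideanSpace ℝ (Fin d)) (2 * r))) (Or.inr measure_ball_lt_top.ne)
      simpa using h3
    refine tendsto_of_tendsto_of_tendsto_of_le_of_le tendsto_const_nhds hs (fun _ => zero_le)
      fun p => ?_
    have hsub := sub_mem_W12 (hF p.1) (hF p.2)
    refine (lintegral_lintegral_enorm_sub_sq_le hball (Lp.stronglyMeasurable _).measurable
      (memLp_restrict_compact _) (hasWeakPartial_grad hsub)).trans ?_
    gcongr with i
    rw [grad_sub hD (hF p.1) (hF p.2), dist_eq_norm]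
    exact PiLp.norm_apply_le _ i
  have hcoe : ∀ p : ℕ × ℕ, (v p.1 - v p.2 : Lp ℝ 2 (volume.restrict D)) =ᵐ[μ]
      fun x => v p.1 x - v p.2 x := fun p =>
    ae_restrict_of_ae_restrict_of_subset hBD (Lp.coeFn_sub (v p.1) (v p.2))
  have hlim2 : Tendsto (fun p : ℕ × ℕ => ∫⁻ y in tᶜ,
      ‖(v p.1 - v p.2 : Lp ℝ 2 (volume.restrict D)) y‖ₑ ^ 2 ∂μ) atTop (𝓝 0) := by
    rw [ENNReal.tendsto_nhds_zero]
    intro ε hε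
    have hδ : ∀ᶠ δ : ℝ in 𝓝[>] 0, ENNReal.ofReal (2 * δ) ^ 2 * μ tᶜ < ε := by
      have h1 : Tendsto (fun δ : ℝ => ENNReal.ofReal (2 * δ) ^ 2 * μ tᶜ) (𝓝 0) (𝓝 0) := by
        have h2 : Tendsto (fun δ : ℝ => ENNReal.ofReal (2 * δ)) (𝓝 0) (𝓝 0) := by
          have : Continuous fun δ : ℝ => ENNReal.ofReal (2 * δ) :=
            ENNReal.continuous_ofReal.comp (by fun_prop)
          simpa using this.tendsto 0
        have h3 := ENNReal.Tendsto.mul_const (ENNReal.Tendsto.pow (n := 2) h2) (b := μ tᶜ) (Or.inr (measure_ne_top μ _))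
        simpa using h3
      exact (h1.mono_left nhdsWithin_le_nhds).eventually_lt_const hε
    obtain ⟨δ, hδε, hδ0⟩ := (hδ.and self_mem_nhdsWithin).exists
    obtain ⟨N, hN⟩ := eventually_atTop.1 (Metric.tendstoUniformlyOn_iff.1 hunif δ hδ0)
    filter_upwards [eventually_ge_atTop (N, N)] with p hp
    refine le_trans ?_ hδε.le
    rw [← setLIntegral_const]
    refine lintegral_mono_ae ?_
    filter_upwards [ae_restrict_of_ae (hcoe p), ae_restrict_mem htm.compl] with x hx hxt
    rw [hx]
    gcongr
    rw [Real.enorm_eq_ofReal_abs]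
    refine ENNReal.ofReal_le_ofReal ?_
    have h1 := hN p.1 hp.1 x hxt
    have h2 := hN p.2 hp.2 x hxt
    rw [← Real.dist_eq]
    linarith [dist_triangle_left (v p.1 x) (v p.2 x) (u x)]
  have hlim3 : Tendsto (fun p : ℕ × ℕ => ∫⁻ x, ‖v p.1 x - v p.2 x‖ₑ ^ 2 ∂μ) atTop (𝓝 0) := by
    have h1 := (ENNReal.Tendsto.const_mul hlim1 (a := 2) (Or.inr (by simp))).add
      (ENNReal.Tendsto.const_mul (ENNReal.Tendsto.const_mul hlim2 (a := μ univ)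
        (Or.inr (measure_ne_top μ _))) (a := 2) (Or.inr (by simp)))
    have h2 := ENNReal.Tendsto.const_mul h1 (a := (μ tᶜ)⁻¹) (Or.inr (by simpa using hA0))
    simp only [mul_zero, add_zero] at h2
    refine tendsto_of_tendsto_of_tendsto_of_le_of_le tendsto_const_nhds h2 (fun _ => zero_le)
      fun p => ?_
    have h3 := measure_mul_lintegral_enorm_sq_le (μ := μ)
      (Lp.stronglyMeasurable (v p.1 - v p.2)).measurable tᶜ
    have h4 : ∫⁻ x, ‖v p.1 x - v p.2 x‖ₑ ^ 2 ∂μ =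
        ∫⁻ x, ‖(v p.1 - v p.2 : Lp ℝ 2 (volume.restrict D)) x‖ₑ ^ 2 ∂μ :=
      lintegral_congr_ae (by filter_upwards [hcoe p] with x hx; rw [hx])
    change ∫⁻ x, ‖v p.1 x - v p.2 x‖ₑ ^ 2 ∂μ ≤ _
    rw [h4]
    calc _ = (μ tᶜ)⁻¹ * (μ tᶜ *
          ∫⁻ x, ‖(v p.1 - v p.2 : Lp ℝ 2 (volume.restrict D)) x‖ₑ ^ 2 ∂μ) := by
          rw [← mul_assoc, ENNReal.inv_mul_cancel hA0 (measure_ne_top μ _), one_mul]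
      _ ≤ _ := by gcongr
  -- Fatou's lemma in the second index replaces `v m` by its pointwise limit `u`.
  rw [ENNReal.tendsto_nhds_zero] at hlim3 ⊢
  intro ε hε
  obtain ⟨⟨M, N⟩, hMN⟩ := eventually_atTop.1 (hlim3 ε hε)
  filter_upwards [eventually_ge_atTop M] with n hn
  calc ∫⁻ x, ‖v n x - u x‖ₑ ^ 2 ∂μ
      = ∫⁻ x, liminf (fun m => ‖v n x - v m x‖ₑ ^ 2) atTop ∂μ := by
        refine lintegral_congr_ae ?_
        filter_upwards [haeB] with x hx
        exact ((ENNReal.Tendsto.pow (n := 2) (hx.const_sub (v n x)).enorm).liminf_eq).symm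
    _ ≤ liminf (fun m => ∫⁻ x, ‖v n x - v m x‖ₑ ^ 2 ∂μ) atTop :=
        lintegral_liminf_le fun m => ((Lp.stronglyMeasurable (v n)).measurable.sub
          (Lp.stronglyMeasurable (v m)).measurable).enorm.pow_const 2
    _ ≤ ε := by
        refine liminf_le_of_frequently_le' (Eventually.frequently ?_)
        filter_upwards [eventually_ge_atTop N] with m hm
        exact hMN (n, m) ⟨hn, hm⟩

theorem IsApproximating.tendsto_lintegral_compact (hD : IsOpen D)
    {v : ℕ → Lp ℝ 2 (volume.restrict D)} {u : EuclideanSpace ℝ (Fin d) →ₘ[volume.restrict D] ℝ}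
    (hv : IsApproximating (W12 D) (halfD D) v u) {K : Set (EuclideanSpace ℝ (Fin d))}
    (hKD : K ⊆ D) (hK : IsCompact K) :
    Tendsto (fun n => ∫⁻ x in K, ‖v n x - u x‖ₑ ^ 2) atTop (𝓝 0) := by
  refine hK.induction_on
    (p := fun s => Tendsto (fun n => ∫⁻ x in s, ‖v n x - u x‖ₑ ^ 2) atTop (𝓝 0)) (by simp)
    (fun s t hst ht => ?_) (fun s t hs ht => ?_) fun x hx => ?_
  · exact tendsto_of_tendsto_of_tendsto_of_le_of_le tendsto_const_nhds ht (fun _ => zero_le)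
      fun n => lintegral_mono_set hst
  · have h := hs.add ht
    rw [add_zero] at h
    exact tendsto_of_tendsto_of_tendsto_of_le_of_le tendsto_const_nhds h (fun _ => zero_le)
      fun n => lintegral_union_le _ _ _
  · obtain ⟨ε, hε, hεD⟩ := Metric.isOpen_iff.1 hD x (hKD hx)
    refine ⟨Metric.ball x (ε / 4),
      mem_nhdsWithin_of_mem_nhds (Metric.ball_mem_nhds x (by positivity)), ?_⟩
    exact hv.tendsto_lintegral_ball hD (by positivity)
      ((Metric.closedBall_subset_ball (by linarith)).trans hεD)

/-- The limit of an approximating sequence belongs to `BL(D)`, and the gradients converge. -/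
theorem IsApproximating.mem_BL (hD : IsOpen D)
    {v : ℕ → Lp ℝ 2 (volume.restrict D)} {u : EuclideanSpace ℝ (Fin d) →ₘ[volume.restrict D] ℝ}
    (hv : IsApproximating (W12 D) (halfD D) v u) :
    u ∈ BL D ∧ Tendsto (fun n => grad D (v n)) atTop (𝓝 (grad D u)) := by
  have hconv : ∀ K ⊆ D, IsCompact K →
      Tendsto (fun n => eLpNorm (v n - u : EuclideanSpace ℝ (Fin d) → ℝ) 2 (volume.restrict K)) atTop (𝓝 0) := by
    intro K hKD hK
    have h1 := hv.tendsto_lintegral_compact hD hKD hK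
    have h2 := ((ENNReal.continuous_rpow_const (y := 1 / 2)).tendsto 0).comp h1
    rw [ENNReal.zero_rpow_of_pos (by norm_num)] at h2
    refine h2.congr fun n => ?_
    rw [eLpNorm_eq_lintegral_rpow_enorm_toReal two_ne_zero ENNReal.ofNat_ne_top]
    simp
  have hu₀ : ∀ K ⊆ D, IsCompact K → MemLp u 2 (volume.restrict K) := by
    intro K hKD hK
    -- A single finite distance suffices: on `K`, `u` then differs from `v n` by a square-integrable
    -- function.
    obtain ⟨n, hn⟩ := ((hconv K hKD hK).eventually_lt_const ENNReal.zero_lt_top).exists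
    have h1 : MemLp (v n - u : EuclideanSpace ℝ (Fin d) → ℝ) 2 (volume.restrict K) :=
      ⟨((Lp.stronglyMeasurable (v n)).sub u.stronglyMeasurable).aestronglyMeasurable, hn⟩
    have h2 := (memLp_restrict_compact (v n) K hKD hK).sub h1
    simpa using h2
  obtain ⟨G, hG⟩ := cauchySeq_tendsto_of_complete (cauchySeq_grad hD hv.1)
  have hw : ∀ i, HasWeakPartial D i u (G i) := fun i => by
    rw [hasWeakPartial_iff]
    exact HasWeakDeriv.of_tendsto (fun n => memLp_restrict_compact (v n)) hu₀ hconv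
      (((PiLp.continuous_apply 2 (fun _ : Fin d => Lp ℝ 2 (volume.restrict D)) i).tendsto
        G).comp hG) fun n => hasWeakPartial_iff.1 (hasWeakPartial_grad (hv.1.1 n) i)
  refine ⟨⟨hu₀, fun i => ⟨_, hw i⟩⟩, ?_⟩
  rwa [grad_eq hD hw]

theorem abs_clip_le (n : ℕ) (x : ℝ) : |min (max x (-n)) n| ≤ |x| := by
  have hn : (0 : ℝ) ≤ n := n.cast_nonneg
  rcases le_total 0 x with h | h
  · rw [max_eq_left (by linarith), abs_of_nonneg (le_min h hn), abs_of_nonneg h]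
    exact min_le_left _ _
  · rw [min_eq_left (max_le (by linarith) (by linarith)), abs_of_nonpos (max_le h (by linarith)),
      abs_of_nonpos h]
    linarith [le_max_left x (-n : ℝ)]

theorem tendsto_clip (x : ℝ) : Tendsto (fun n : ℕ => min (max x (-n)) (n : ℝ)) atTop (𝓝 x) := by
  obtain ⟨N, hN⟩ := exists_nat_ge |x|
  refine tendsto_const_nhds.congr' ?_
  filter_upwards [eventually_ge_atTop N] with n hn
  have h1 : |x| ≤ n := hN.trans (by exact_mod_cast hn)
  rw [max_eq_left (abs_le.1 h1).1, min_eq_left (abs_le.1 h1).2]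

/-- The truncations of a function in `BL(D)` form an approximating sequence. -/
theorem exists_isApproximating (hD : IsOpen D) [IsFiniteMeasure (volume.restrict D)]
    {u : EuclideanSpace ℝ (Fin d) →ₘ[volume.restrict D] ℝ} (hu : u ∈ BL D) :
    ∃ v, IsApproximating (W12 D) (halfD D) v u := by
  have hN : ∀ n : ℕ, LipschitzWith 1 fun x : ℝ => min (max x (-n)) (n : ℝ) := fun n =>
    lipschitzWith_clip _ _
  have hN0 : ∀ n : ℕ, min (max (0 : ℝ) (-n)) (n : ℝ) = 0 := fun n => by simp
  have hm : ∀ n : ℕ, MemLp ((fun x : ℝ => min (max x (-n)) (n : ℝ)) ∘ u) 2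
      (volume.restrict D) := fun n => by
    refine MemLp.of_bound ((hN n).continuous.comp_aestronglyMeasurable u.aestronglyMeasurable) n
      (ae_of_all _ fun x => ?_)
    rw [Function.comp_apply, Real.norm_eq_abs, abs_le]
    have hn : (0 : ℝ) ≤ n := n.cast_nonneg
    exact ⟨le_min (le_max_right _ _) (by linarith), min_le_right _ _⟩
  set v : ℕ → Lp ℝ 2 (volume.restrict D) := fun n => (hm n).toLp _ with hv
  have hcoe : ∀ n, v n =ᵐ[volume.restrict D] (fun x : ℝ => min (max x (-n)) (n : ℝ)) ∘ u :=
    fun n => (hm n).coeFn_toLp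
  have hBL := fun n => mem_BL_of_comp_lipschitz hD (v := (v n : _ →ₘ[volume.restrict D] ℝ)) hu
    (hN n) (hN0 n) (hcoe n)
  have hvW : ∀ n, v n ∈ W12 D := fun n => (hBL n).1
  refine ⟨v, isFormCauchy_of_cauchySeq_grad hD hvW ?_, ?_⟩
  · have hlim : Tendsto (fun n => grad D (v n)) atTop (𝓝 (grad D u)) := by
      have hi : ∀ i, Tendsto (fun n => weakPartial D i (v n)) atTop (𝓝 (weakPartial D i u)) := by
        intro i
        -- Truncation does not increase the norm of a partial derivative, so convergence against
        -- test functions is already strong convergence.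
        refine tendsto_of_tendsto_inner_of_norm_le (denseRange_testToLp (μ := volume) hD)
          (fun n => (hBL n).2 i) ?_
        rintro _ ⟨φ, rfl⟩
        have e1 : ∀ n, inner ℝ (weakPartial D i (v n)) (testToLp volume D φ) =
            -∫ x in D, v n x * fderiv ℝ φ x (EuclideanSpace.single i 1) := fun n => by
          rw [inner_testToLp, hasWeakPartial_weakPartial (hvW n) i φ φ.2.1 φ.2.2.1 φ.2.2.2, neg_neg]
        have e2 : inner ℝ (weakPartial D i u) (testToLp volume D φ) =
            -∫ x in D, u x * fderiv ℝ φ x (EuclideanSpace.single i 1) := by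
          rw [inner_testToLp, hasWeakPartial_weakPartial hu i φ φ.2.1 φ.2.2.1 φ.2.2.2, neg_neg]
        simp_rw [e1, e2]
        -- Integration by parts has moved the derivative to `φ`; the truncations are dominated by
        -- `|u|`.
        refine (tendsto_integral_of_dominated_convergence
          (fun x => ‖u x * fderiv ℝ φ x (EuclideanSpace.single i 1)‖)
          (fun n => (integrable_mul_fderiv (memLp_restrict_compact (v n)) φ.2 _).1)
          (integrable_mul_fderiv hu.1 φ.2 _).norm (fun n => ?_) ?_).neg
        · filter_upwards [hcoe n] with x hx
          rw [norm_mul, norm_mul, hx]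
          gcongr
          exact abs_clip_le n (u x)
        · filter_upwards [ae_all_iff.2 hcoe] with x hx
          simp_rw [hx]
          exact (tendsto_clip (u x)).mul_const _
      exact ((PiLp.continuous_toLp 2 (fun _ : Fin d => Lp ℝ 2 (volume.restrict D))).tendsto
        _).comp (tendsto_pi_nhds.2 hi)
    exact hlim.cauchySeq
  · filter_upwards [ae_all_iff.2 hcoe] with x hx
    simp_rw [hx]
    exact tendsto_clip (u x)

theorem extendedSpace_eq_BL (hD : IsOpen D) [IsFiniteMeasure (volume.restrict D)] :
    extendedSpace (W12 D) (halfD D) = BL D :=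
  Subset.antisymm (fun _ ⟨_, hv⟩ => (hv.mem_BL hD).1) fun _ hu => exists_isApproximating hD hu

theorem IsApproximating.tendsto_halfD (hD : IsOpen D)
    {v : ℕ → Lp ℝ 2 (volume.restrict D)} {u : EuclideanSpace ℝ (Fin d) →ₘ[volume.restrict D] ℝ}
    (hv : IsApproximating (W12 D) (halfD D) v u) :
    Tendsto (fun n => halfD D (v n) (v n)) atTop (𝓝 (1 / 2 * dirichletIntegral D u u)) := by
  simp_rw [halfD, dirichletIntegral_eq_inner]
  exact ((hv.mem_BL hD).2.inner (hv.mem_BL hD).2).const_mul _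

end Extended

/-! ### The operator and the semigroup of a form -/

section FormOperator

variable {α : Type*} [MeasurableSpace α] {μ : Measure α} {F : Set (Lp ℝ 2 μ)}
  {E : Lp ℝ 2 μ → Lp ℝ 2 μ → ℝ}

/-- The graph of the operator associated with a form. -/
def formOperator (h : IsDirichletForm F E) : Submodule ℝ (Lp ℝ 2 μ × Lp ℝ 2 μ) where
  carrier := {p | p.1 ∈ F ∧ ∀ v ∈ F, E p.1 v = -inner ℝ p.2 v}
  add_mem' := fun {p q} hp hq => ⟨h.add_mem _ hp.1 _ hq.1, fun v hv => by
    rw [Prod.fst_add, Prod.snd_add, h.add_left _ hp.1 _ hq.1 v hv, hp.2 v hv, hq.2 v hv,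
      inner_add_left]; ring⟩
  zero_mem' := ⟨h.zero_mem, fun v hv => by
    have := h.smul_left 0 0 h.zero_mem v hv
    simpa using this⟩
  smul_mem' := fun c p hp => ⟨h.smul_mem c _ hp.1, fun v hv => by
    rw [Prod.smul_fst, Prod.smul_snd, h.smul_left c _ hp.1 v hv, hp.2 v hv,
      real_inner_smul_left]; ring⟩

/-- Symmetry and sign come from the form, and single-valuedness from density of its domain.
Solvability of the resolvent equation is the only outside input. -/
theorem isDissipative_formOperator (h : IsDirichletForm F E)
    (hsurj : ∀ c : ℝ, 0 < c → ∀ f : Lp ℝ 2 μ, ∃ u ∈ F, ∀ v ∈ F,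
      inner ℝ u v + c * E u v = inner ℝ f v) : IsDissipative (formOperator h) where
  symm p hp q hq := by
    have h1 := hp.2 _ hq.1
    have h2 := hq.2 _ hp.1
    rw [h.symm _ hq.1 _ hp.1, h1] at h2
    rw [real_inner_comm q.2 p.1]
    exact neg_injective h2
  nonpos p hp := by
    have h1 := hp.2 _ hp.1
    have h2 := h.nonneg _ hp.1
    linarith
  single w hw := by
    refine h.dense.eq_zero_of_inner_left ℝ fun v hv => ?_
    have h1 : E 0 v = -inner ℝ w v := hw.2 v hv
    have h2 : E 0 v = 0 := by simpa using h.smul_left 0 0 h.zero_mem v hv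
    linarith
  surj c hc f := by
    obtain ⟨u, hu, huf⟩ := hsurj c hc f
    refine ⟨(u, c⁻¹ • (u - f)), ⟨hu, fun v hv => ?_⟩, ?_⟩
    · have := huf v hv
      rw [real_inner_smul_left, inner_sub_left]
      field_simp
      linarith
    · simp [smul_smul, hc.ne']

theorem isSemigroupOf_semigroup (h : IsDirichletForm F E)
    (hA : IsDissipative (formOperator h)) : IsSemigroupOf F E hA.semigroup where
  symm t _ f g := hA.inner_semigroup t f g
  semigroup _ hs _ ht f := hA.semigroup_add_apply (le_of_lt hs) (le_of_lt ht) f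
  contraction t _ f := hA.norm_semigroup_apply_le t f
  strong_cont f := (hA.tendsto_semigroup_zero f).mono_left nhdsWithin_le_nhds
  generator u w := ⟨fun h' => hA.mem_of_tendsto_slope h',
    fun h' => hA.tendsto_slope_of_mem (p := (u, w)) h'⟩

theorem isOrderedModule_Lp {p : ℝ≥0∞} : IsOrderedModule ℝ (Lp ℝ p μ) := by
  refine IsOrderedModule.of_smul_nonneg fun a ha f hf => ?_
  rw [← Lp.coeFn_nonneg] at hf ⊢
  filter_upwards [hf, Lp.coeFn_smul a f] with x h1 h2
  rw [h2]
  exact mul_nonneg ha h1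

end FormOperator

/-! ### Time integrals of the semigroup and the ergodic theorem -/

section Integral

variable {H : Type*} [NormedAddCommGroup H] [InnerProductSpace ℝ H] [CompleteSpace H]
  {A : Submodule ℝ (H × H)}

namespace IsDissipative

theorem intervalIntegrable_semigroup (hA : IsDissipative A) (f : H) (a b : ℝ) :
    IntervalIntegrable (fun s => hA.semigroup s f) volume a b :=
  (hA.continuous_semigroup f).intervalIntegrable a b

/-- The operator `f ↦ ∫₀ᵗ T_s f ds`. -/
def integrated (hA : IsDissipative A) (t : ℝ) : H →ₗ[ℝ] H where
  toFun f := ∫ s in (0 : ℝ)..t, hA.semigroup s f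
  map_add' f g := by
    simp_rw [map_add]
    exact intervalIntegral.integral_add (hA.intervalIntegrable_semigroup f 0 t)
      (hA.intervalIntegrable_semigroup g 0 t)
  map_smul' c f := by
    simp_rw [map_smul]
    exact intervalIntegral.integral_smul c _

theorem integrated_apply (hA : IsDissipative A) (t : ℝ) (f : H) :
    hA.integrated t f = ∫ s in (0 : ℝ)..t, hA.semigroup s f := rfl

theorem integrated_sub_apply (hA : IsDissipative A) (s t : ℝ) (f : H) :
    hA.integrated t f - hA.integrated s f = ∫ r in s..t, hA.semigroup r f :=
  intervalIntegral.integral_interval_sub_left (hA.intervalIntegrable_semigroup f 0 t)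
    (hA.intervalIntegrable_semigroup f 0 s)

/-- By symmetry `T_s` moves onto `e`, which it fixes. With `e = 1` this is conservation of mass. -/
theorem inner_integrated_of_mem_zero (hA : IsDissipative A) {e : H} (he : (e, (0 : H)) ∈ A) (t : ℝ)
    (f : H) : inner ℝ e (hA.integrated t f) = t * inner ℝ e f := by
  have h1 := (innerSL ℝ e).intervalIntegral_comp_comm (hA.intervalIntegrable_semigroup f 0 t)
  simp only [innerSL_apply_apply] at h1
  rw [integrated_apply, ← h1]
  simp_rw [← hA.inner_semigroup, hA.semigroup_apply_of_mem_zero he]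
  simp

/-- Cut `[0, n]` into unit intervals: the piece starting at `k` is `T_1^k` applied to the first one.
Continuous averages thus reduce to Birkhoff averages of `T_1`. -/
theorem integrated_natCast (hA : IsDissipative A) (n : ℕ) (f : H) :
    hA.integrated n f = birkhoffSum (hA.semigroup 1) id n (hA.integrated 1 f) := by
  have h1 := intervalIntegral.sum_integral_adjacent_intervals (a := fun k : ℕ => (k : ℝ)) (n := n)
    (μ := volume) fun k _ => hA.intervalIntegrable_semigroup f k (k + 1 : ℕ)
  rw [integrated_apply, ← Nat.cast_zero, ← h1, birkhoffSum]
  refine Finset.sum_congr rfl fun k _ => ?_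
  have hiter : ∀ k : ℕ, ∀ g : H, (hA.semigroup 1)^[k] g = hA.semigroup k g := by
    intro k
    induction k with
    | zero => intro g; simp [hA.semigroup_zero_apply]
    | succ k ih =>
      intro g
      rw [Function.iterate_succ_apply, ih, ← hA.semigroup_add_apply k.cast_nonneg zero_le_one]
      simp
  rw [id, hiter, integrated_apply, ← (hA.semigroup k).intervalIntegral_comp_comm
    (hA.intervalIntegrable_semigroup f 0 1)]
  have h2 := intervalIntegral.integral_comp_add_left (a := 0) (b := 1)
    (fun s => hA.semigroup s f) (k : ℝ)
  rw [add_zero] at h2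
  push_cast
  rw [← h2]
  refine intervalIntegral.integral_congr fun s hs => ?_
  rw [uIcc_of_le zero_le_one] at hs
  exact hA.semigroup_add_apply k.cast_nonneg hs.1 f

/-- The mean ergodic theorem: the averages `n⁻¹ ∫₀ⁿ T_s f ds` converge to an invariant vector. -/
theorem exists_tendsto_average (hA : IsDissipative A) (f : H) :
    ∃ p : H, (p, (0 : H)) ∈ A ∧
      Tendsto (fun n : ℕ => (n : ℝ)⁻¹ • hA.integrated n f) atTop (𝓝 p) := by
  have hn : ‖hA.semigroup 1‖ ≤ 1 :=
    ContinuousLinearMap.opNorm_le_bound _ zero_le_one fun g => by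
      simpa using hA.norm_semigroup_apply_le 1 g
  have h := (hA.semigroup 1).tendsto_birkhoffAverage_orthogonalProjection hn (hA.integrated 1 f)
  refine ⟨_, hA.mem_zero_of_semigroup_one ?_, h.congr fun n => ?_⟩
  · exact LinearMap.mem_eqLocus.1 (Subtype.coe_prop (Submodule.orthogonalProjectionOnto
      (LinearMap.eqLocus (hA.semigroup 1 : H →ₗ[ℝ] H) ((1 : H →L[ℝ] H) : H →ₗ[ℝ] H))
        (hA.integrated 1 f)))
  · rw [hA.integrated_natCast, birkhoffAverage]

end IsDissipative

end Integral

/-! ### Resolvent and positivity for `½ 𝐃` -/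

section Resolvent

variable {d : ℕ} {D : Set (EuclideanSpace ℝ (Fin d))}

theorem halfD_eq (u v : Lp ℝ 2 (volume.restrict D)) :
    halfD D u v = 1 / 2 * inner ℝ (grad D u) (grad D v) := by
  rw [halfD, dirichletIntegral_eq_inner]

/-- The graph of `b ∇`, as a subspace of `L²(D) × L²(D)^d`. -/
def gradGraph (hD : IsOpen D) (b : ℝ) : Submodule ℝ (WithLp 2 (Lp ℝ 2 (volume.restrict D) ×
    PiLp 2 fun _ : Fin d => Lp ℝ 2 (volume.restrict D))) where
  carrier := {z | z.fst ∈ W12 D ∧ z.snd = b • grad D z.fst}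
  add_mem' := fun {z w} hz hw => ⟨add_mem_W12 hz.1 hw.1, by
    rw [WithLp.add_snd, WithLp.add_fst, grad_add hD hz.1 hw.1, smul_add, hz.2, hw.2]⟩
  zero_mem' := ⟨zero_mem_W12, by
    have h := grad_smul hD 0 (zero_mem_W12 (D := D))
    rw [zero_smul, zero_smul] at h
    rw [WithLp.zero_snd, WithLp.zero_fst, h, smul_zero]⟩
  smul_mem' := fun c z hz => ⟨smul_mem_W12 c hz.1, by
    rw [WithLp.smul_snd, WithLp.smul_fst, grad_smul hD c hz.1, hz.2, smul_comm]⟩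

theorem isClosed_gradGraph (hD : IsOpen D) {b : ℝ} (hb : 0 < b) :
    IsClosed (gradGraph hD b : Set (WithLp 2 (Lp ℝ 2 (volume.restrict D) ×
      PiLp 2 fun _ : Fin d => Lp ℝ 2 (volume.restrict D)))) := by
  refine IsSeqClosed.isClosed fun z z₀ hz hlim => ?_
  have h1 : Tendsto (fun n => (z n).fst) atTop (𝓝 z₀.fst) :=
    ((WithLp.prod_continuous_ofLp 2 _ _).fst.tendsto z₀).comp hlim
  have h2 : Tendsto (fun n => (z n).snd) atTop (𝓝 z₀.snd) :=
    ((WithLp.prod_continuous_ofLp 2 _ _).snd.tendsto z₀).comp hlim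
  have h3 : Tendsto (fun n => grad D (z n).fst) atTop (𝓝 (b⁻¹ • z₀.snd)) := by
    refine (h2.const_smul b⁻¹).congr fun n => ?_
    rw [(hz n).2, smul_smul, inv_mul_cancel₀ hb.ne', one_smul]
  obtain ⟨h4, h5⟩ := mem_W12_of_tendsto hD (fun n => (hz n).1) h1 h3
  refine ⟨h4, ?_⟩
  rw [h5, smul_smul, mul_inv_cancel₀ hb.ne', one_smul]

/-- Project `(f, 0)` orthogonally onto the closed graph of `b ∇`. Orthogonality of the residual to
`(v, b ∇v)` is the desired equation once `b² = c / 2`. -/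
theorem exists_resolvent_halfD (hD : IsOpen D) {c : ℝ} (hc : 0 < c)
    (f : Lp ℝ 2 (volume.restrict D)) : ∃ u ∈ W12 D, ∀ v ∈ W12 D,
      inner ℝ u v + c * halfD D u v = inner ℝ f v := by
  set b := √(c / 2) with hb
  have hb0 : 0 < b := Real.sqrt_pos.2 (by positivity)
  have hbb : b * b = c / 2 := Real.mul_self_sqrt (by positivity)
  set K := gradGraph hD b
  have : CompleteSpace K := (isClosed_gradGraph hD hb0).completeSpace_coe
  set x : WithLp 2 (Lp ℝ 2 (volume.restrict D) ×
    PiLp 2 fun _ : Fin d => Lp ℝ 2 (volume.restrict D)) := WithLp.toLp 2 (f, 0) with hx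
  have hz : K.starProjection x ∈ K := K.starProjection_apply_mem x
  refine ⟨(K.starProjection x).fst, hz.1, fun v hv => ?_⟩
  have hvK : (WithLp.toLp 2 (v, b • grad D v) : WithLp 2 (Lp ℝ 2 (volume.restrict D) ×
    PiLp 2 fun _ : Fin d => Lp ℝ 2 (volume.restrict D))) ∈ K := ⟨hv, rfl⟩
  have h1 := K.starProjection_inner_eq_zero x _ hvK
  rw [inner_sub_left, WithLp.prod_inner_apply, WithLp.prod_inner_apply] at h1
  have h2 : (K.starProjection x).ofLp.2 = b • grad D (K.starProjection x).fst := hz.2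
  rw [h2] at h1
  simp only [hx, inner_zero_left, add_zero, real_inner_smul_left, real_inner_smul_right] at h1
  rw [halfD_eq]
  have h3 : b * (b * inner ℝ (grad D (K.starProjection x).fst) (grad D v)) =
      c / 2 * inner ℝ (grad D (K.starProjection x).fst) (grad D v) := by
    rw [← mul_assoc, hbb]
  rw [h3] at h1
  change inner ℝ f v - (inner ℝ (K.starProjection x).fst v + _) = 0 at h1
  linarith

theorem isDissipative_halfD (hD : IsOpen D) :
    IsDissipative (formOperator (isDirichletForm_halfD hD)) :=
  isDissipative_formOperator _ fun _ hc f => exists_resolvent_halfD hD hc f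

/-- The resolvent is positivity preserving. -/
theorem resolvent_nonneg (hD : IsOpen D) {c : ℝ} (hc : 0 < c) {f : Lp ℝ 2 (volume.restrict D)}
    (hf : 0 ≤ f) : 0 ≤ (isDissipative_halfD hD).resolvent c f := by
  set u := (isDissipative_halfD hD).resolvent c f with hu
  obtain ⟨huW, huE⟩ := (isDissipative_halfD hD).resolvent_mem hc f
  rw [← hu] at huW huE
  have hN : LipschitzWith 1 fun x : ℝ => max x 0 := LipschitzWith.id.max_const 0
  have hN0 : max (0 : ℝ) 0 = 0 := max_self 0
  -- The solution `u` minimizes `‖u‖² + (c/2) ‖∇u‖² - 2 ⟨f, u⟩`. Passing to `w = u⁺` increases no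
  -- term, so the identities tested with `w` and `u` force `w = u`.
  set w := hN.compLp hN0 u with hw
  have hcoe : w =ᵐ[volume.restrict D] (fun x : ℝ => max x 0) ∘ u := hN.coeFn_compLp hN0 u
  obtain ⟨hwBL, hwle⟩ := mem_BL_of_comp_lipschitz hD huW hN hN0 hcoe
  have hwW : w ∈ W12 D := hwBL
  have hgrad := norm_grad_le hwle
  have hnorm : ‖w‖ ≤ ‖u‖ := by
    simpa using hN.norm_compLp_le hN0 u
  have hfw : inner ℝ f u ≤ inner ℝ f w := by
    rw [inner_Lp_eq_integral, inner_Lp_eq_integral]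
    refine integral_mono_ae ((Lp.memLp f).integrable_mul (Lp.memLp u))
      ((Lp.memLp f).integrable_mul (Lp.memLp w)) ?_
    filter_upwards [hcoe, (Lp.coeFn_nonneg f).2 hf] with x h1 h2
    have h3 : u x ≤ w x := by rw [h1]; exact le_max_left _ _
    exact mul_le_mul_of_nonneg_left h3 h2
  have e1 := huE w hwW
  have e2 := huE u huW
  rw [halfD_eq, real_inner_smul_left, inner_sub_left] at e1 e2
  rw [real_inner_self_eq_norm_sq, real_inner_self_eq_norm_sq] at e2
  field_simp at e1 e2
  have e3 := norm_sub_sq_real w u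
  have e4 := norm_sub_sq_real (grad D w) (grad D u)
  rw [real_inner_comm] at e3 e4
  have e5 : ‖w‖ ^ 2 ≤ ‖u‖ ^ 2 := by gcongr
  have e6 : ‖grad D w‖ ^ 2 ≤ ‖grad D u‖ ^ 2 := by gcongr
  have e7 : ‖w - u‖ ^ 2 ≤ 0 := by
    nlinarith [mul_nonneg hc.le (sq_nonneg ‖grad D w - grad D u‖),
      mul_le_mul_of_nonneg_left e6 hc.le]
  have e8 : w = u := by
    rw [← sub_eq_zero, ← norm_eq_zero]; nlinarith [norm_nonneg (w - u)]
  rw [← e8, ← Lp.coeFn_nonneg]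
  filter_upwards [hcoe] with x hx
  rw [hx]
  exact le_max_right _ _

theorem semigroup_nonneg (hD : IsOpen D) (t : ℝ) {f : Lp ℝ 2 (volume.restrict D)}
    (hf : 0 ≤ f) : 0 ≤ (isDissipative_halfD hD).semigroup t f := by
  have := isOrderedModule_Lp (μ := volume.restrict D) (p := 2)
  exact (isDissipative_halfD hD).semigroup_mem (C := Ici 0) isClosed_Ici self_mem_Ici
    (fun f hf g hg => mem_Ici.2 (add_nonneg hf hg)) (fun a ha f hf => mem_Ici.2 (smul_nonneg ha hf))
    (fun c hc f hf => resolvent_nonneg hD hc hf) t hf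

theorem integrated_mono (hD : IsOpen D) {s t : ℝ} (hst : s ≤ t)
    {f : Lp ℝ 2 (volume.restrict D)} (hf : 0 ≤ f) :
    (isDissipative_halfD hD).integrated s f ≤ (isDissipative_halfD hD).integrated t f := by
  have := isOrderedModule_Lp (μ := volume.restrict D) (p := 2)
  rw [← sub_nonneg, (isDissipative_halfD hD).integrated_sub_apply,
    intervalIntegral.integral_of_le hst]
  exact integral_nonneg fun r => semigroup_nonneg hD r hf

theorem integrated_nonneg (hD : IsOpen D) {t : ℝ} (ht : 0 ≤ t)
    {f : Lp ℝ 2 (volume.restrict D)} (hf : 0 ≤ f) :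
    0 ≤ (isDissipative_halfD hD).integrated t f := by
  have := integrated_mono hD ht hf
  rwa [IsDissipative.integrated_apply, intervalIntegral.integral_same] at this

end Resolvent

/-! ### Passage from `L²` to `L¹` on a finite measure space -/

section L1

variable {α : Type*} [MeasurableSpace α] {μ : Measure α} [IsFiniteMeasure μ]

theorem memLp_one (g : Lp ℝ 2 μ) : MemLp g 1 μ := (Lp.memLp g).mono_exponent one_le_two

variable (μ) in
/-- The inclusion of `L²` into `L¹` over a finite measure. -/
def toL1 : Lp ℝ 2 μ →ₗ[ℝ] Lp ℝ 1 μ where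
  toFun g := (memLp_one g).toLp g
  map_add' f g := by
    rw [← MemLp.toLp_add, MemLp.toLp_eq_toLp_iff]
    exact Lp.coeFn_add f g
  map_smul' c f := by
    rw [RingHom.id_apply, ← MemLp.toLp_const_smul, MemLp.toLp_eq_toLp_iff]
    exact Lp.coeFn_smul c f

theorem coeFn_toL1 (g : Lp ℝ 2 μ) : toL1 μ g =ᵐ[μ] g := (memLp_one g).coeFn_toLp

theorem toL1_mono {f g : Lp ℝ 2 μ} (h : f ≤ g) : toL1 μ f ≤ toL1 μ g := by
  rw [← Lp.coeFn_le] at h ⊢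
  filter_upwards [h, coeFn_toL1 f, coeFn_toL1 g] with x h1 h2 h3
  rwa [h2, h3]

theorem inner_const_one (g : Lp ℝ 2 μ) : inner ℝ (Lp.const 2 μ (1 : ℝ)) g = ∫ x, g x ∂μ := by
  rw [inner_Lp_eq_integral]
  refine integral_congr_ae ?_
  filter_upwards [Lp.coeFn_const 2 μ (1 : ℝ)] with x hx
  rw [hx]
  simp

/-- Writing the `L¹` norm as a pairing with the constant `1` makes the invariance of constants
applicable. -/
theorem norm_toL1 (g : Lp ℝ 2 μ) : ‖toL1 μ g‖ = inner ℝ (Lp.const 2 μ (1 : ℝ)) |g| := by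
  rw [L1.norm_eq_integral_norm, inner_const_one]
  refine integral_congr_ae ?_
  filter_upwards [coeFn_toL1 g, Lp.coeFn_abs g] with x h1 h2
  rw [h1, h2, Real.norm_eq_abs]

theorem inner_const_one_mono {f g : Lp ℝ 2 μ} (h : f ≤ g) :
    inner ℝ (Lp.const 2 μ (1 : ℝ)) f ≤ inner ℝ (Lp.const 2 μ (1 : ℝ)) g := by
  rw [inner_const_one, inner_const_one]
  exact integral_mono_ae ((Lp.memLp f).integrable one_le_two) ((Lp.memLp g).integrable one_le_two)
    ((Lp.coeFn_le f g).2 h)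

/-- The truncation of an integrable function, as an element of `L²`. -/
def truncate (f : Lp ℝ 1 μ) (n : ℕ) : Lp ℝ 2 μ :=
  (MemLp.of_bound (p := 2) (μ := μ) (f := fun x => min (max (f x) (-n)) (n : ℝ))
    ((lipschitzWith_clip (-n) n).continuous.comp_aestronglyMeasurable
      (Lp.aestronglyMeasurable f)) n (ae_of_all _ fun x => by
        have hn : (0 : ℝ) ≤ n := n.cast_nonneg
        rw [Real.norm_eq_abs, abs_le]
        exact ⟨le_min (le_max_right _ _) (by linarith), min_le_right _ _⟩)).toLp _

theorem coeFn_truncate (f : Lp ℝ 1 μ) (n : ℕ) :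
    truncate f n =ᵐ[μ] fun x => min (max (f x) (-n)) (n : ℝ) :=
  MemLp.coeFn_toLp _

theorem tendsto_toL1_truncate (f : Lp ℝ 1 μ) :
    Tendsto (fun n => toL1 μ (truncate f n)) atTop (𝓝 f) := by
  rw [tendsto_iff_norm_sub_tendsto_zero]
  have hcoe : ∀ n, (toL1 μ (truncate f n) - f : Lp ℝ 1 μ) =ᵐ[μ]
      fun x => min (max (f x) (-n)) (n : ℝ) - f x := fun n => by
    filter_upwards [Lp.coeFn_sub (toL1 μ (truncate f n)) f, coeFn_toL1 (truncate f n),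
      coeFn_truncate f n] with x h1 h2 h3
    rw [h1, Pi.sub_apply, h2, h3]
  have hfi : Integrable f μ := L1.integrable_coeFn f
  have h := tendsto_integral_of_dominated_convergence (μ := μ) (f := fun _ => (0 : ℝ))
    (F := fun (n : ℕ) x => ‖(toL1 μ (truncate f n) - f : Lp ℝ 1 μ) x‖) (fun x => 2 * ‖f x‖)
    (fun n => (Lp.aestronglyMeasurable _).norm) (hfi.norm.const_mul 2) (fun n => ?_) ?_
  · simpa [L1.norm_eq_integral_norm] using h
  · filter_upwards [hcoe n] with x hx
    rw [norm_norm, hx]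
    have h1 := abs_clip_le n (f x)
    have h2 := norm_sub_le (min (max (f x) (-n)) (n : ℝ)) (f x)
    simp only [Real.norm_eq_abs] at h2 ⊢
    linarith
  · filter_upwards [ae_all_iff.2 hcoe] with x hx
    simp_rw [hx]
    have h1 := tendsto_iff_norm_sub_tendsto_zero.1 (tendsto_clip (f x))
    exact h1

theorem denseRange_toL1 : DenseRange (toL1 μ) := fun f =>
  mem_closure_of_tendsto (tendsto_toL1_truncate f) (Eventually.of_forall fun _ => mem_range_self _)

theorem truncate_nonneg {f : Lp ℝ 1 μ} (hf : 0 ≤ f) (n : ℕ) : 0 ≤ truncate f n := by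
  rw [← Lp.coeFn_nonneg] at hf ⊢
  filter_upwards [hf, coeFn_truncate f n] with x h1 h2
  rw [h2]
  exact le_min (le_max_of_le_left h1) n.cast_nonneg

theorem toL1_truncate_le {f : Lp ℝ 1 μ} (hf : 0 ≤ f) (n : ℕ) : toL1 μ (truncate f n) ≤ f := by
  rw [← Lp.coeFn_nonneg] at hf
  rw [← Lp.coeFn_le]
  filter_upwards [hf, coeFn_truncate f n, coeFn_toL1 (truncate f n)] with x h1 h2 h3
  rw [h3, h2, max_eq_left (le_trans (neg_nonpos.2 n.cast_nonneg) h1)]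
  exact min_le_left _ _

theorem nonneg_of_toL1_nonneg {U : Lp ℝ 1 μ →L[ℝ] Lp ℝ 1 μ}
    (hU : ∀ g : Lp ℝ 2 μ, 0 ≤ g → 0 ≤ U (toL1 μ g)) {f : Lp ℝ 1 μ} (hf : 0 ≤ f) : 0 ≤ U f :=
  ge_of_tendsto ((U.continuous.tendsto f).comp (tendsto_toL1_truncate f))
    (Eventually.of_forall fun n => hU _ (truncate_nonneg hf n))

/-- For `f ≥ 0`, truncation at level `1` vanishes only where `f` does. -/
theorem integral_truncate_pos {f : Lp ℝ 1 μ} (hf : 0 ≤ f) (hf0 : f ≠ 0) :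
    0 < inner ℝ (Lp.const 2 μ (1 : ℝ)) (truncate f 1) := by
  rw [inner_const_one]
  have hnn := (Lp.coeFn_nonneg _).2 (truncate_nonneg hf 1)
  refine lt_of_le_of_ne (integral_nonneg_of_ae hnn) fun h => hf0 ?_
  rw [eq_comm, integral_eq_zero_iff_of_nonneg_ae hnn
    ((Lp.memLp _).integrable one_le_two)] at h
  rw [Lp.eq_zero_iff_ae_eq_zero]
  filter_upwards [h, coeFn_truncate f 1, (Lp.coeFn_nonneg f).2 hf] with x h1 h2 h3
  rw [h2] at h1
  simp only [Nat.cast_one, Pi.zero_apply] at h1 h3 ⊢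
  rw [max_eq_left (by linarith)] at h1
  rcases min_choice (f x) 1 with h4 | h4 <;> rw [h4] at h1
  · exact h1
  · norm_num at h1

end L1

/-! ### Recurrence -/

section Recurrence

variable {d : ℕ} {D : Set (EuclideanSpace ℝ (Fin d))}

/-- Vectors annihilated by the generator are constant functions. -/
theorem exists_ae_eq_const_of_mem_formOperator (hD : IsOpen D) (hconn : IsConnected D)
    {p : Lp ℝ 2 (volume.restrict D)}
    (hp : (p, (0 : Lp ℝ 2 (volume.restrict D))) ∈ formOperator (isDirichletForm_halfD hD)) :
    ∃ c : ℝ, ∀ᵐ x ∂(volume.restrict D), p x = c := by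
  have hpW : p ∈ W12 D := hp.1
  have h1 : halfD D p p = -inner ℝ (0 : Lp ℝ 2 (volume.restrict D)) p := hp.2 p hpW
  rw [halfD_self, inner_zero_left, neg_zero] at h1
  have h2 : grad D p = 0 := by
    rw [← norm_eq_zero]; nlinarith [norm_nonneg (grad D p)]
  refine exists_ae_eq_const hD hconn (Lp.stronglyMeasurable p).measurable
    (memLp_restrict_compact p) fun i => ?_
  have := hasWeakPartial_grad hpW i
  rwa [h2] at this

variable [IsFiniteMeasure (volume.restrict D)]

theorem const_mem_formOperator (hD : IsOpen D) (c : ℝ) :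
    (Lp.const 2 (volume.restrict D) c, (0 : Lp ℝ 2 (volume.restrict D))) ∈
      formOperator (isDirichletForm_halfD hD) := by
  obtain ⟨h1, h2⟩ := const_mem_W12 hD c
  refine ⟨h1, fun v _ => ?_⟩
  rw [halfD_eq, h2]
  simp

/-- Positivity gives `|R g| ≤ R |g|`, and the mass of `R |g|` is `t` times that of `|g|`. -/
theorem norm_toL1_integrated_le (hD : IsOpen D) {t : ℝ} (ht : 0 < t)
    (g : Lp ℝ 2 (volume.restrict D)) :
    ‖toL1 (volume.restrict D) ((isDissipative_halfD hD).integrated t g)‖ ≤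
      t * ‖toL1 (volume.restrict D) g‖ := by
  set R := (isDissipative_halfD hD).integrated t with hR
  have hpos : ∀ f : Lp ℝ 2 (volume.restrict D), 0 ≤ f → 0 ≤ R f := fun f hf =>
    integrated_nonneg hD ht.le hf
  have habs : |R g| ≤ R |g| := by
    rw [abs_le']
    constructor
    · rw [← sub_nonneg, ← map_sub]
      exact hpos _ (sub_nonneg.2 (le_abs_self g))
    · rw [← sub_nonneg, ← map_neg, ← map_sub]
      exact hpos _ (sub_nonneg.2 (neg_le_abs g))
  rw [norm_toL1, norm_toL1,
    ← (isDissipative_halfD hD).inner_integrated_of_mem_zero (const_mem_formOperator hD 1)]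
  exact inner_const_one_mono habs

/-- The extension of `f ↦ ∫₀ᵗ T_s f ds` to `L¹(D)`. -/
def potentialOperator (hD : IsOpen D) (t : ℝ) :
    Lp ℝ 1 (volume.restrict D) →L[ℝ] Lp ℝ 1 (volume.restrict D) :=
  ((toL1 (volume.restrict D)).comp ((isDissipative_halfD hD).integrated t)).extendOfNorm
    (toL1 (volume.restrict D))

theorem potentialOperator_toL1 (hD : IsOpen D) {t : ℝ} (ht : 0 < t)
    (g : Lp ℝ 2 (volume.restrict D)) :
    potentialOperator hD t (toL1 (volume.restrict D) g) =
      toL1 (volume.restrict D) ((isDissipative_halfD hD).integrated t g) :=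
  LinearMap.extendOfNorm_eq denseRange_toL1 ⟨t, norm_toL1_integrated_le hD ht⟩ g

theorem isL1Extension_potentialOperator (hD : IsOpen D) :
    IsL1Extension (isDissipative_halfD hD).semigroup (potentialOperator hD) := by
  intro t ht f g hfg
  have h1 : f = toL1 (volume.restrict D) g :=
    Lp.ext (hfg.trans (coeFn_toL1 g).symm)
  rw [h1, potentialOperator_toL1 hD ht]
  exact coeFn_toL1 _

theorem potentialOperator_nonneg (hD : IsOpen D) {t : ℝ} (ht : 0 < t)
    {f : Lp ℝ 1 (volume.restrict D)} (hf : 0 ≤ f) : 0 ≤ potentialOperator hD t f := by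
  refine nonneg_of_toL1_nonneg (fun g hg => ?_) hf
  rw [potentialOperator_toL1 hD ht, ← map_zero (toL1 (volume.restrict D))]
  exact toL1_mono (integrated_nonneg hD ht.le hg)

theorem potentialOperator_mono (hD : IsOpen D) {s t : ℝ} (hs : 0 < s) (hst : s ≤ t)
    {f : Lp ℝ 1 (volume.restrict D)} (hf : 0 ≤ f) :
    potentialOperator hD s f ≤ potentialOperator hD t f := by
  rw [← sub_nonneg, ← sub_apply]
  refine nonneg_of_toL1_nonneg (fun g hg => ?_) hf
  rw [sub_apply, sub_nonneg, potentialOperator_toL1 hD hs,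
    potentialOperator_toL1 hD (hs.trans_le hst)]
  exact toL1_mono (integrated_mono hD hst hg)

/-- The ergodic theorem lives in `L²`, so it is applied to `f ∧ 1`, and positivity of `S_N`
transfers the lower bound to `f`. Connectedness makes the ergodic limit constant; conservation of
mass makes it positive. -/
theorem tendsto_potentialOperator_atTop (hD : IsOpen D) (hconn : IsConnected D)
    {f : Lp ℝ 1 (volume.restrict D)} (hf : 0 ≤ f) (hf0 : f ≠ 0) :
    ∀ᵐ x ∂(volume.restrict D),
      Tendsto (fun N : ℕ => potentialOperator hD (N : ℝ) f x) atTop atTop := by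
  set h := truncate f 1
  have hA := isDissipative_halfD hD
  have hone := const_mem_formOperator hD 1
  obtain ⟨p, hp, hlim⟩ := hA.exists_tendsto_average h
  obtain ⟨c, hc⟩ := exists_ae_eq_const_of_mem_formOperator hD hconn hp
  have hmean : inner ℝ (Lp.const 2 (volume.restrict D) (1 : ℝ)) p =
      inner ℝ (Lp.const 2 (volume.restrict D) (1 : ℝ)) h := by
    refine tendsto_nhds_unique (tendsto_const_nhds.inner hlim) (tendsto_const_nhds.congr' ?_)
    filter_upwards [eventually_gt_atTop 0] with n hn
    have hn' : (n : ℝ) ≠ 0 := by exact_mod_cast hn.ne'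
    rw [real_inner_smul_right, hA.inner_integrated_of_mem_zero hone, ← mul_assoc,
      inv_mul_cancel₀ hn', one_mul]
  have hcpos : 0 < c := by
    have h1 := integral_truncate_pos hf hf0
    rw [← hmean, inner_const_one, integral_congr_ae hc, integral_const, smul_eq_mul] at h1
    exact pos_of_mul_pos_right h1 measureReal_nonneg
  -- `L²` convergence gives almost everywhere convergence only along a subsequence; monotonicity in
  -- `N` recovers the full sequence.
  obtain ⟨ns, hns, hae⟩ := (tendstoInMeasure_of_tendsto_Lp hlim).exists_seq_tendsto_ae
  have hmono : ∀ N : ℕ, potentialOperator hD ((N + 1 : ℕ) : ℝ) f ≤ᵐ[volume.restrict D]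
      potentialOperator hD ((N + 1 + 1 : ℕ) : ℝ) f := fun N =>
    (Lp.coeFn_le _ _).2 (potentialOperator_mono hD (by positivity)
      (by push_cast; linarith) hf)
  have hlower : ∀ N : ℕ, ∀ᵐ x ∂(volume.restrict D), 0 < N →
      (N : ℝ) * ((N : ℝ)⁻¹ • hA.integrated (N : ℝ) h : Lp ℝ 2 (volume.restrict D)) x ≤
        potentialOperator hD (N : ℝ) f x := by
    intro N
    rcases Nat.eq_zero_or_pos N with hN | hN
    · exact ae_of_all _ fun x hx => absurd hx (by omega)
    have hN' : (0 : ℝ) < N := by exact_mod_cast hN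
    have h1 : 0 ≤ potentialOperator hD (N : ℝ) (f - toL1 (volume.restrict D) h) :=
      potentialOperator_nonneg hD hN' (sub_nonneg.2 (toL1_truncate_le hf 1))
    rw [map_sub, sub_nonneg, potentialOperator_toL1 hD hN', ← Lp.coeFn_le] at h1
    filter_upwards [h1, coeFn_toL1 (hA.integrated (N : ℝ) h),
      Lp.coeFn_smul (N : ℝ)⁻¹ (hA.integrated (N : ℝ) h)] with x e1 e2 e3 _
    rw [e3, Pi.smul_apply, smul_eq_mul, ← mul_assoc, mul_inv_cancel₀ hN'.ne', one_mul, ← e2]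
    exact e1
  filter_upwards [hae, hc, ae_all_iff.2 hmono, ae_all_iff.2 hlower] with x h1 h2 h3 h4
  rw [h2] at h1
  -- The shift by one discards `N = 0`, since monotonicity was established only for positive times.
  rw [← tendsto_add_atTop_iff_nat 1]
  have hm : Monotone fun N : ℕ => potentialOperator hD ((N + 1 : ℕ) : ℝ) f x :=
    monotone_nat_of_le_succ h3
  have hnsT := hns.tendsto_atTop
  refine tendsto_atTop_of_monotone_of_subseq (φ := fun k => ns k - 1) (l := atTop) hm ?_
  have hprod : Tendsto (fun k => (ns k : ℝ) *
      ((ns k : ℝ)⁻¹ • hA.integrated (ns k : ℝ) h : Lp ℝ 2 (volume.restrict D)) x) atTop atTop :=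
    (tendsto_natCast_atTop_atTop.comp hnsT).atTop_mul_pos hcpos h1
  refine tendsto_atTop_mono' _ ?_ hprod
  filter_upwards [hnsT.eventually_gt_atTop 0] with k hk
  have e : ns k - 1 + 1 = ns k := by omega
  simp only [Function.comp_apply, e]
  exact h4 (ns k) hk

/-- The form `(½𝐃, W^{1,2}(D))` is recurrent. -/
theorem isRecurrent_halfD (hD : IsOpen D) (hconn : IsConnected D) :
    IsRecurrent (W12 D) (halfD D) := by
  refine ⟨_, isSemigroupOf_semigroup (isDirichletForm_halfD hD) (isDissipative_halfD hD), _,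
    isL1Extension_potentialOperator hD, fun f hf => ?_⟩
  have hf' : 0 ≤ f := (Lp.coeFn_nonneg f).1 hf
  by_cases hf0 : f = 0
  · refine ⟨fun _ => 0, ?_, by simp⟩
    filter_upwards [Lp.coeFn_zero ℝ 1 (volume.restrict D)] with x hx
    rw [hf0]
    simp_rw [map_zero, hx]
    simp
  · refine ⟨fun _ => ⊤, ?_, by simp⟩
    filter_upwards [tendsto_potentialOperator_atTop hD hconn hf' hf0] with x hx
    exact EReal.tendsto_coe_nhds_top_iff.2 hx

end Recurrence

end BeppoLevi

end

theorem mainTheorem9 (d : ℕ) (hd : 1 ≤ d) (D : Set (EuclideanSpace ℝ (Fin d)))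
    (hDopen : IsOpen D) (hDconn : IsConnected D) (hDfin : volume D < ⊤) :
    BeppoLevi.IsDirichletForm (BeppoLevi.W12 D) (BeppoLevi.halfD D) ∧
    BeppoLevi.IsRecurrent (BeppoLevi.W12 D) (BeppoLevi.halfD D) ∧
    BeppoLevi.extendedSpace (BeppoLevi.W12 D) (BeppoLevi.halfD D) = BeppoLevi.BL D ∧
    ∀ u ∈ BeppoLevi.BL D, ∀ v : ℕ → Lp ℝ 2 (volume.restrict D),
      BeppoLevi.IsApproximating (BeppoLevi.W12 D) (BeppoLevi.halfD D) v u →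
        Tendsto (fun n => BeppoLevi.halfD D (v n) (v n)) atTop
          (𝓝 (1 / 2 * BeppoLevi.dirichletIntegral D u u)) := by
  have : IsFiniteMeasure (volume.restrict D) := ⟨by simpa using hDfin⟩
  exact ⟨BeppoLevi.isDirichletForm_halfD hDopen, BeppoLevi.isRecurrent_halfD hDopen hDconn,
    BeppoLevi.extendedSpace_eq_BL hDopen, fun _ _ _ hv => hv.tendsto_halfD hDopen⟩
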